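/- Let $A\in\mathbb{R}^{d\times d}$ and $B\in\mathbb{R}^{d\times m}$, and let $U\subset\mathbb{R}^m$ be a compact neighborhood of the origin. Let $\mathcal{U}$ be the set of measurable functions $\omega:\mathbb{R}\to\mathbb{R}^m$ with $\omega(t)\in U$ for almost every $t$, and let $\varphi(\cdot,x,\omega)$ denote the solution of $$\dot x(t)=Ax(t)+B\omega(t),\qquad x(0)=x .$$ Assume that the pair $(A,B)$ is controllable (with unconstrained controls every state can be steered to every other state in finite time) and that $A$ is hyperbolic (no eigenvalue of $A$ has vanishing real part). A control set is a set $D\subset\mathbb{R}^d$ that is maximal with the following two properties: for every $x\in D$ there is $\omega\in\mathcal{U}$ with $\varphi(t,x,\omega)\in D$ for all $t\ge 0$; and for every $x\in D$ the set $D$ is contained in the closure of $\{\varphi(s,x,\omega): s\ge 0,\ \omega\in\mathcal{U}\}$. For $K,Q\subset\mathbb{R}^d$ and $\tau>0$, a set $\mathcal{S}\subset\mathcal{U}$ is $(\tau,K,Q)$-spanning if for every $x\in K$ there is $\omega\in\mathcal{S}$ with $\varphi(t,x,\omega)\in Q$ for all $t\in[0,\tau]$. For a continuous function $f:U\to\mathbb{R}$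 put $$a_\tau(f,K,Q)=\inf\Big\{\sum_{\omega\in\mathcal{S}}\exp\Big(\int_0^\tau f(\omega(t))\,dt\Big):\ \mathcal{S}\ \text{is}\ (\tau,K,Q)\text{-spanning}\Big\}\in[0,\infty],$$ $$P_{inv}(f,K,Q)=\limsup_{\tau\to\infty}\frac1\tau\log a_\tau(f,K,Q).$$ Then there is a unique control set $D$ with nonempty interior, and for every compact set $K\subset D$ with nonempty interior and every continuous $f:U\to\mathbb{R}$, $$P_{inv}(f,K,D)=\min_{u\in U}f(u)+\sum_{j=1}^{r}d_j\max\{0,\operatorname{Re}\lambda_j\},$$ where $\lambda_1,\dots,\lambda_r$ are the distinct complex eigenvalues of $A$ and $d_1,\dots,d_r$ their algebraic multiplicities. -/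

import Mathlib

open Filter Topology MeasureTheory

namespace LinearControl

noncomputable section

/-- `ξ` is the trajectory with initial value `x` of the linear control system
`ẋ(t) = A x(t) + B ω(t)`, i.e. its (Carathéodory) solution on the whole real line:
a continuous function satisfying the integrated equation. -/
def IsTrajectory {d m : ℕ} (A : Matrix (Fin d) (Fin d) ℝ) (B : Matrix (Fin d) (Fin m) ℝ)
    (ω : ℝ → Fin m → ℝ) (x : Fin d → ℝ) (ξ : ℝ → Fin d → ℝ) : Prop :=
  Continuous ξ ∧
    ∀ t : ℝ, ξ t = x + ∫ s in (0 : ℝ)..t, (A.mulVec (ξ s) + B.mulVec (ω s))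

/-- The set of admissible controls: Lebesgue measurable functions on the real line with values
in the control range `U` almost everywhere. -/
def controls {m : ℕ} (U : Set (Fin m → ℝ)) : Set (ℝ → Fin m → ℝ) :=
  {ω | AEMeasurable ω volume ∧ ∀ᵐ t ∂(volume : Measure ℝ), ω t ∈ U}

/-- The pair `(A, B)` is controllable: without control constraints, every state can be steered
to every other state in some positive time. -/
def IsControllable {d m : ℕ} (A : Matrix (Fin d) (Fin d) ℝ)
    (B : Matrix (Fin d) (Fin m) ℝ) : Prop :=
  ∀ x y : Fin d → ℝ, ∃ T : ℝ, 0 < T ∧ ∃ ω : ℝ → Fin m → ℝ, LocallyIntegrable ω volume ∧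
    ∃ ξ : ℝ → Fin d → ℝ, IsTrajectory A B ω x ξ ∧ ξ T = y

/-- The complex eigenvalues of a real matrix, listed with their algebraic multiplicities. -/
def eigenvalues {d : ℕ} (A : Matrix (Fin d) (Fin d) ℝ) : Multiset ℂ :=
  (A.map (algebraMap ℝ ℂ)).charpoly.roots

/-- A real matrix is hyperbolic if it has no eigenvalue on the imaginary axis. -/
def IsHyperbolic {d : ℕ} (A : Matrix (Fin d) (Fin d) ℝ) : Prop :=
  ∀ μ ∈ eigenvalues A, μ.re ≠ 0

/-- The positive orbit of `x`: the points reachable from `x` in some finite time `s ≥ 0`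
with an admissible control. -/
def positiveOrbit {d m : ℕ} (A : Matrix (Fin d) (Fin d) ℝ) (B : Matrix (Fin d) (Fin m) ℝ)
    (U : Set (Fin m → ℝ)) (x : Fin d → ℝ) : Set (Fin d → ℝ) :=
  {y | ∃ s : ℝ, 0 ≤ s ∧ ∃ ω ∈ controls U, ∃ ξ : ℝ → Fin d → ℝ,
    IsTrajectory A B ω x ξ ∧ ξ s = y}

/-- Every point of `D` can be kept in `D` for all nonnegative times. -/
def IsControlledInvariant {d m : ℕ} (A : Matrix (Fin d) (Fin d) ℝ)
    (B : Matrix (Fin d) (Fin m) ℝ) (U : Set (Fin m → ℝ)) (D : Set (Fin d → ℝ)) : Prop :=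
  ∀ x ∈ D, ∃ ω ∈ controls U, ∃ ξ : ℝ → Fin d → ℝ,
    IsTrajectory A B ω x ξ ∧ ∀ t : ℝ, 0 ≤ t → ξ t ∈ D

/-- Every point of `D` can be steered approximately to every other point of `D`. -/
def IsApproxControllable {d m : ℕ} (A : Matrix (Fin d) (Fin d) ℝ)
    (B : Matrix (Fin d) (Fin m) ℝ) (U : Set (Fin m → ℝ)) (D : Set (Fin d → ℝ)) : Prop :=
  ∀ x ∈ D, D ⊆ closure (positiveOrbit A B U x)

/-- A control set: a maximal set with controlled invariance and approximate controllability. -/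
def IsControlSet {d m : ℕ} (A : Matrix (Fin d) (Fin d) ℝ) (B : Matrix (Fin d) (Fin m) ℝ)
    (U : Set (Fin m → ℝ)) (D : Set (Fin d → ℝ)) : Prop :=
  Maximal (fun E => IsControlledInvariant A B U E ∧ IsApproxControllable A B U E) D

/-- `S` is a `(τ, K, Q)`-spanning set of controls. -/
def IsSpanning {d m : ℕ} (A : Matrix (Fin d) (Fin d) ℝ) (B : Matrix (Fin d) (Fin m) ℝ)
    (U : Set (Fin m → ℝ)) (τ : ℝ) (K Q : Set (Fin d → ℝ)) (S : Set (ℝ → Fin m → ℝ)) : Prop :=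
  S ⊆ controls U ∧ ∀ x ∈ K, ∃ ω ∈ S, ∃ ξ : ℝ → Fin d → ℝ,
    IsTrajectory A B ω x ξ ∧ ∀ t ∈ Set.Icc (0 : ℝ) τ, ξ t ∈ Q

/-- `a_τ(f, K, Q)`, the infimum over all spanning sets `S` of the (possibly infinite) sums
of `exp (∫₀^τ f (ω t) dt)` over `ω ∈ S`. -/
def spanningInf {d m : ℕ} (A : Matrix (Fin d) (Fin d) ℝ) (B : Matrix (Fin d) (Fin m) ℝ)
    (U : Set (Fin m → ℝ)) (f : (Fin m → ℝ) → ℝ) (K Q : Set (Fin d → ℝ)) (τ : ℝ) : ENNReal :=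
  ⨅ S ∈ {S : Set (ℝ → Fin m → ℝ) | IsSpanning A B U τ K Q S},
    ∑' ω : S, ENNReal.ofReal (Real.exp (∫ t in (0 : ℝ)..τ, f ((ω : ℝ → Fin m → ℝ) t)))

/-- The invariance pressure, the upper limit of `(1 / τ) log a_τ(f, K, Q)` as `τ → ∞`,
as an extended real number. -/
def invariancePressure {d m : ℕ} (A : Matrix (Fin d) (Fin d) ℝ) (B : Matrix (Fin d) (Fin m) ℝ)
    (U : Set (Fin m → ℝ)) (f : (Fin m → ℝ) → ℝ) (K Q : Set (Fin d → ℝ)) : EReal :=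
  limsup (fun τ : ℝ => ((1 / τ : ℝ) : EReal) * ENNReal.log (spanningInf A B U f K Q τ)) atTop

end

end LinearControl

/-! Write σ for the sum of the positive real parts of the eigenvalues. Hyperbolicity gives a
spectral projection `P` onto the unstable subspace, with exponential bounds on both parts and tr(AP)
= σ (`exists_isDichotomy`). Hence the flow on the unstable part expands volume by exactly e^{τσ}
(`IsDichotomy.det_unstableFlow`).

Control set. Controllability makes small controls reach a full neighborhood of each free endpoint
(`exists_small_control`), so the points that can be steered to 0 and are approximately reachable
from 0 form a control set around 0 (`isControlSet_coreSet`). For uniqueness, an interior point of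
any control set is mutually reachable with a point on a closed trajectory. Since 1 - e^{TA} is
invertible for T > 0, truncating the control of this loop deforms it continuously to the equilibrium
0, and neighboring loops reach each other (`mutual_zero_of_loop`). Two control sets with mutually
reachable points coincide by maximality.

Lower bound. A point that can be steered to 0 has bounded unstable component
(`IsDichotomy.norm_unstable_le`). By volume expansion, one control therefore keeps in D only a
subset of K of volume O(e^{-τσ}), so at least a constant times e^{τσ} controls are needed, each of
weight at least e^{τ min f} (`IsDichotomy.exists_le_spanningInf`).

Upper bound. For each ε > 0 there is a periodic trajectory of average cost at most min f + ε
(`IsDichotomy.exists_periodic`). A ball around its base point p is covered by κ e^{Tσ} pieces on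
which e^{TA} does not spread points (`IsDichotomy.exists_finset_cover`). Steering the center of a
piece to p and then running around the loop returns the whole piece to the ball, by linearity. Long
words in these controls span, because a trajectory with both ends in a control set never leaves it.
For T large, κ and the cost of reaching the loop are negligible in the exponent
(`IsDichotomy.exists_spanningInf_le`). -/

open scoped Matrix.Norms.Operator Matrix ComplexConjugate

namespace LinearControl

noncomputable section

/-! ### Exponential decay, spectral mapping and Liouville's formula -/

section BanachAlgebra

variable {𝔸 : Type*} [NormedRing 𝔸] [NormedAlgebra ℂ 𝔸] [CompleteSpace 𝔸]

/-- Induction on the roots avoids Jordan forms. If z is one of them, (a - z)q is annihilated by the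
remaining factors, and e^{-tz}e^{ta}q has derivative e^{-tz}e^{ta}(a - z)q. Integrating the
inductive bound gives growth at most e^{βt} with β = -α - Re z > 0, and multiplying back by e^{tz}
leaves e^{-αt}. The strict inequality for Re z excludes polynomial factors in t. -/
theorem exists_norm_exp_smul_mul_le (a : 𝔸) (α : ℝ) (s : Multiset ℂ) :
    (∀ z ∈ s, z.re < -α) → ∀ q : 𝔸,
    Polynomial.aeval a (s.map fun z => Polynomial.X - Polynomial.C z).prod * q = 0 →
    ∃ C : ℝ, 0 ≤ C ∧ ∀ t : ℝ, 0 ≤ t →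
      ‖NormedSpace.exp ((t : ℂ) • a) * q‖ ≤ C * Real.exp (-α * t) := by
  induction s using Multiset.induction with
  | empty =>
    intro _ q hq
    have : q = 0 := by simpa using hq
    exact ⟨0, le_rfl, fun t _ => by simp [this]⟩
  | cons z s ih =>
    intro hs q hq
    have hz : z.re < -α := hs z (by simp)
    obtain ⟨C, hC0, hC⟩ := ih (fun w hw => hs w (by simp [hw])) ((a - algebraMap ℂ 𝔸 z) * q) (by
      rw [← mul_assoc, ← hq, Multiset.map_cons, Multiset.prod_cons, mul_comm, map_mul]
      simp)
    set β : ℝ := -α - z.re with hβ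
    have hβ0 : 0 < β := by linarith
    let g : ℝ → 𝔸 := fun t => Complex.exp (-(t : ℂ) * z) • (NormedSpace.exp ((t : ℂ) • a) * q)
    have hg : ∀ t : ℝ, HasDerivAt g (Complex.exp (-(t : ℂ) * z) •
        (NormedSpace.exp ((t : ℂ) • a) * ((a - algebraMap ℂ 𝔸 z) * q))) t := by
      intro t
      have h1 : HasDerivAt (fun w : ℂ => Complex.exp (-w * z))
          (Complex.exp (-(t : ℂ) * z) * (-1 * z)) (t : ℂ) :=
        (((hasDerivAt_id (t : ℂ)).neg).mul_const z).cexp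
      have h2 : HasDerivAt (fun w : ℂ => NormedSpace.exp (w • a) * q)
          (NormedSpace.exp ((t : ℂ) • a) * a * q) (t : ℂ) :=
        (hasDerivAt_exp_smul_const a (t : ℂ)).mul_const q
      have h3 := (h1.smul h2).scomp t Complex.ofRealCLM.hasDerivAt
      convert! h3 using 1
      rw [Complex.ofRealCLM_apply, Complex.ofReal_one, one_smul, sub_mul, mul_sub, smul_sub, ← mul_assoc, Algebra.algebraMap_eq_smul_one]
      simp only [smul_mul_assoc, one_mul, mul_smul_comm, smul_smul]
      rw [show Complex.exp (-(t : ℂ) * z) * (-1 * z) = -(Complex.exp (-(t : ℂ) * z) * z) by ring,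
        neg_smul]
      abel
    have hexp : ∀ t : ℝ, ‖Complex.exp (-(t : ℂ) * z)‖ = Real.exp (-t * z.re) := by
      intro t
      rw [Complex.norm_exp]
      simp
    have hB : ∀ t : ℝ, HasDerivAt (fun t => ‖q‖ + C / β * (Real.exp (β * t) - 1))
        (C * Real.exp (β * t)) t := by
      intro t
      have h1 : HasDerivAt (fun t => Real.exp (β * t)) (Real.exp (β * t) * (β * 1)) t :=
        ((hasDerivAt_id t).const_mul β).exp
      convert! ((h1.sub_const 1).const_mul (C / β)).const_add ‖q‖ using 1
      rw [mul_one, mul_comm (Real.exp _), ← mul_assoc, div_mul_cancel₀ _ hβ0.ne']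
    have key : ∀ t : ℝ, 0 ≤ t → ‖g t‖ ≤ ‖q‖ + C / β * (Real.exp (β * t) - 1) := by
      intro t ht
      refine image_norm_le_of_norm_deriv_right_le_deriv_boundary (a := 0) (b := t) (f := g)
        (f' := fun t => Complex.exp (-(t : ℂ) * z) •
          (NormedSpace.exp ((t : ℂ) • a) * ((a - algebraMap ℂ 𝔸 z) * q)))
        (fun x _ => (hg x).continuousAt.continuousWithinAt)
        (fun x _ => (hg x).hasDerivWithinAt) ?_ hB ?_ ⟨ht, le_rfl⟩
      · simp [g]
      · intro x hx
        rw [norm_smul, hexp]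
        calc Real.exp (-x * z.re) * _ ≤ Real.exp (-x * z.re) * (C * Real.exp (-α * x)) := by
              gcongr
              exact hC x hx.1
          _ = C * Real.exp (β * x) := by
              rw [mul_left_comm, ← Real.exp_add]
              congr 2
              rw [hβ]; ring
    refine ⟨‖q‖ + C / β, by positivity, fun t ht => ?_⟩
    have h := key t ht
    simp only [g] at h
    rw [norm_smul, hexp] at h
    have h1 : Real.exp (-t * z.re) * ‖NormedSpace.exp ((t : ℂ) • a) * q‖ ≤
        (‖q‖ + C / β) * Real.exp (β * t) := by
      refine h.trans ?_
      have : 1 ≤ Real.exp (β * t) := Real.one_le_exp (by positivity)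
      have h3 : 0 ≤ C / β := by positivity
      nlinarith [norm_nonneg q]
    have h2 : Real.exp (β * t) = Real.exp (-t * z.re) * Real.exp (-α * t) := by
      rw [← Real.exp_add]; congr 1; rw [hβ]; ring
    rw [h2, mul_left_comm] at h1
    exact le_of_mul_le_mul_left h1 (Real.exp_pos _)

end BanachAlgebra

/-- Factoring p into linear terms gives det p(M) as the product of p over the roots; taking p = z -
q identifies the characteristic polynomial of q(M) at every z. Multiplicities are retained, as the
trace formula requires. -/
theorem charpoly_roots_aeval {n : Type*} [Fintype n] [DecidableEq n] (M : Matrix n n ℂ)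
    (q : Polynomial ℂ) :
    (Polynomial.aeval M q).charpoly.roots = M.charpoly.roots.map fun z => q.eval z := by
  have hdet : ∀ p : Polynomial ℂ,
      (Polynomial.aeval M p).det = (M.charpoly.roots.map fun z => p.eval z).prod := by
    intro p
    have hsp := IsAlgClosed.splits p
    have hM := IsAlgClosed.splits M.charpoly
    have hlin : ∀ c : ℂ, (M - algebraMap ℂ (Matrix n n ℂ) c).det =
        (M.charpoly.roots.map fun z => z - c).prod := by
      intro c
      have h1 : (algebraMap ℂ (Matrix n n ℂ) c - M).det = M.charpoly.eval c := by
        rw [Matrix.eval_charpoly]; rfl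
      have h2 : M.charpoly.eval c = (M.charpoly.roots.map fun z => c - z).prod := by
        conv_lhs => rw [hM.eq_prod_roots_of_monic M.charpoly_monic]
        rw [Polynomial.eval_multiset_prod, Multiset.map_map]
        simp
      have hcard : M.charpoly.roots.card = Fintype.card n := by
        rw [← hM.natDegree_eq_card_roots, Matrix.charpoly_natDegree_eq_dim]
      rw [← neg_sub, Matrix.det_neg, h1, h2, ← hcard]
      rw [show (fun z : ℂ => z - c) = fun z => (-1) * (c - z) by ext; ring,
        Multiset.prod_map_mul, Multiset.map_const', Multiset.prod_replicate]
    have hcard : M.charpoly.roots.card = Fintype.card n := by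
      rw [← hM.natDegree_eq_card_roots, Matrix.charpoly_natDegree_eq_dim]
    conv_lhs => rw [hsp.eq_prod_roots]
    have hprod : ∀ s : Multiset ℂ,
        (Polynomial.aeval M (s.map fun z => Polynomial.X - Polynomial.C z).prod).det =
        (M.charpoly.roots.map fun z =>
          ((s.map fun z => Polynomial.X - Polynomial.C z).prod).eval z).prod := by
      intro s
      induction s using Multiset.induction with
      | empty => simp
      | cons a s ih =>
        rw [Multiset.map_cons, Multiset.prod_cons, map_mul, Matrix.det_mul, ih]
        simp only [Polynomial.eval_mul, Multiset.prod_map_mul]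
        simp [hlin]
    rw [map_mul, Matrix.det_mul, hprod, Polynomial.aeval_C, Matrix.algebraMap_eq_diagonal,
      Matrix.det_diagonal]
    simp only [Pi.algebraMap_def, Algebra.algebraMap_self, RingHom.id_apply, Finset.prod_const, Finset.card_univ]
    conv_rhs => rw [hsp.eq_prod_roots]
    simp only [Polynomial.eval_mul, Multiset.prod_map_mul, Polynomial.eval_C, Multiset.map_const',
      Multiset.prod_replicate, hcard]
  have hchar : (Polynomial.aeval M q).charpoly =
      (M.charpoly.roots.map fun z => Polynomial.X - Polynomial.C (q.eval z)).prod := by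
    refine Polynomial.funext fun z => ?_
    have h := hdet (Polynomial.C z - q)
    rw [map_sub, Polynomial.aeval_C] at h
    rw [Matrix.eval_charpoly, Polynomial.eval_multiset_prod, Multiset.map_map]
    simp only [Polynomial.eval_sub, Polynomial.eval_C, Polynomial.eval_X, Function.comp_def] at h ⊢
    exact h
  rw [hchar, ← Polynomial.roots_multiset_prod_X_sub_C (M.charpoly.roots.map fun z => q.eval z),
    Multiset.map_map]
  rfl

theorem trace_aeval {n : Type*} [Fintype n] [DecidableEq n] (M : Matrix n n ℂ)
    (q : Polynomial ℂ) :
    (Polynomial.aeval M q).trace = (M.charpoly.roots.map fun z => q.eval z).sum := by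
  rw [Matrix.trace_eq_sum_roots_charpoly, charpoly_roots_aeval]

theorem hasDerivAt_exp_smul {n : Type*} [Fintype n] [DecidableEq n] (M : Matrix n n ℝ) (t : ℝ) :
    HasDerivAt (fun s : ℝ => NormedSpace.exp (s • M)) (M * NormedSpace.exp (t • M)) t :=
  hasDerivAt_exp_smul_const' M t

/-- The map t ↦ det e^{tM} is multiplicative, and the derivative of det at the identity is the
trace, so it solves g' = (tr M) g with g(0) = 1. -/
theorem det_exp_smul {n : Type*} [Fintype n] [DecidableEq n] (M : Matrix n n ℝ) (t : ℝ) :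
    (NormedSpace.exp (t • M)).det = Real.exp (t * M.trace) := by
  have hdiff : DifferentiableAt ℝ (fun X : Matrix n n ℝ => X.det) 1 := by
    have hentry : ∀ i j, Differentiable ℝ fun X : Matrix n n ℝ => X i j := fun i j =>
      (Matrix.entryLinearMap ℝ ℝ i j).toContinuousLinearMap.differentiable
    simp only [Matrix.det_apply]
    fun_prop
  set L := fderiv ℝ (fun X : Matrix n n ℝ => X.det) 1 with hL
  have hdir : ∀ X : Matrix n n ℝ, L X = X.trace := by
    intro X
    have h1 : HasDerivAt (fun s : ℝ => (1 + s • X).det) (L X) 0 := by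
      have h2 : HasDerivAt (fun s : ℝ => (1 : Matrix n n ℝ) + s • X) X 0 := by
        have := ((hasDerivAt_id (0 : ℝ)).smul_const X).const_add 1
        rwa [one_smul] at this
      have h3 : HasFDerivAt (fun X : Matrix n n ℝ => X.det) L (1 + (0 : ℝ) • X) := by
        simpa using hdiff.hasFDerivAt
      exact h3.comp_hasDerivAt 0 h2
    have h4 : HasDerivAt (fun s : ℝ => (1 + s • X).det) X.trace 0 := by
      simp_rw [fun s : ℝ => Matrix.det_one_add_smul s X]
      have h5 : HasDerivAt (fun s : ℝ => 1 + X.trace * s) X.trace 0 := by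
        simpa using ((hasDerivAt_id (0 : ℝ)).const_mul X.trace).const_add 1
      -- The remaining terms of det(1 + sX) are s² times a polynomial in s and do not contribute at
      -- 0.
      have h6 := h5.add ((((1 + (Polynomial.X : Polynomial ℝ) • X.map Polynomial.C).det.divX.divX).hasDerivAt
        (0 : ℝ)).mul (hasDerivAt_pow 2 (0 : ℝ)))
      convert! h6 using 1
      simp
    exact h1.unique h4
  set g : ℝ → ℝ := fun t => (NormedSpace.exp (t • M)).det with hg
  have hadd : ∀ s t, g (s + t) = g s * g t := by
    intro s t
    simp only [hg]
    rw [add_smul, Matrix.exp_add_of_commute _ _ (((Commute.refl M).smul_left s).smul_right t),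
      Matrix.det_mul]
  have hg0 : HasDerivAt g M.trace 0 := by
    have h1 : HasFDerivAt (fun X : Matrix n n ℝ => X.det) L (NormedSpace.exp ((0 : ℝ) • M)) := by
      simpa using hdiff.hasFDerivAt
    have h2 := h1.comp_hasDerivAt (0 : ℝ) (hasDerivAt_exp_smul M 0)
    exact h2.congr_deriv ((hdir _).trans (by simp))
  have hg' : ∀ t, HasDerivAt g (g t * M.trace) t := by
    intro t
    have h1 : HasDerivAt (fun s => g (s - t)) M.trace t := by
      have h2 : HasDerivAt g M.trace (t - t) := by simpa using hg0
      simpa using h2.comp_sub_const t t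
    have h3 := h1.const_mul (g t)
    refine h3.congr_of_eventuallyEq (Eventually.of_forall fun s => ?_)
    change g s = g t * g (s - t)
    rw [← hadd]
    congr 1
    ring
  have hconst : ∀ t, HasDerivAt (fun t => g t * Real.exp (-(t * M.trace))) 0 t := by
    intro t
    have h1 : HasDerivAt (fun t => Real.exp (-(t * M.trace)))
        (Real.exp (-(t * M.trace)) * (-(1 * M.trace))) t :=
      (((hasDerivAt_id t).mul_const M.trace).neg).exp
    convert! (hg' t).mul h1 using 1
    ring
  have h := is_const_of_deriv_eq_zero (fun t => (hconst t).differentiableAt)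
    (fun t => (hconst t).deriv) t 0
  have h0 : g 0 = 1 := by simp [hg]
  simp only [h0, zero_mul, neg_zero, Real.exp_zero, mul_one] at h
  change g t = _
  rw [Real.exp_neg] at h
  field_simp at h
  exact h

/-! ### Exponential dichotomy of a hyperbolic matrix -/

section

/-- The monic complex polynomial with prescribed roots. -/
def rootPolynomial (s : Multiset ℂ) : Polynomial ℂ :=
  (s.map fun z => Polynomial.X - Polynomial.C z).prod

theorem rootPolynomial_eval_eq_zero_iff (s : Multiset ℂ) (z : ℂ) :
    (rootPolynomial s).eval z = 0 ↔ z ∈ s := by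
  rw [rootPolynomial, Polynomial.eval_multiset_prod, Multiset.prod_eq_zero_iff]
  simp [sub_eq_zero]

/-- Conjugation fixes the product, hence each coefficient. This descends the stable and unstable
factors of the characteristic polynomial to ℝ, so that the spectral projection is a real matrix. -/
theorem exists_real_map_eq_rootPolynomial (s : Multiset ℂ) (hs : s.map (starRingEnd ℂ) = s) :
    ∃ p : Polynomial ℝ, p.map (algebraMap ℝ ℂ) = rootPolynomial s := by
  have h : (rootPolynomial s).map (starRingEnd ℂ) = rootPolynomial s := by
    conv_rhs => rw [← hs]
    simp [rootPolynomial, Polynomial.map_multiset_prod, Multiset.map_map]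
  have h2 : rootPolynomial s ∈ Polynomial.lifts (algebraMap ℝ ℂ) := by
    rw [Polynomial.lifts_iff_coeff_lifts]
    intro n
    have h3 : conj ((rootPolynomial s).coeff n) = (rootPolynomial s).coeff n := by
      conv_rhs => rw [← h]
      rw [Polynomial.coeff_map]
    obtain ⟨r, hr⟩ := Complex.conj_eq_iff_real.1 h3
    exact ⟨r, hr.symm⟩
  exact (Polynomial.mem_lifts _).1 h2

/-- Lets backward decay on the unstable part be read as forward decay for the negated matrix. -/
theorem aeval_neg_rootPolynomial {𝔸 : Type*} [Ring 𝔸] [Algebra ℂ 𝔸] (a : 𝔸) (s : Multiset ℂ) :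
    Polynomial.aeval (-a) (rootPolynomial (s.map fun z => -z)) =
      (-1) ^ s.card * Polynomial.aeval a (rootPolynomial s) := by
  induction s using Multiset.induction with
  | empty => simp [rootPolynomial]
  | cons z s ih =>
    simp only [rootPolynomial, Multiset.map_cons, Multiset.prod_cons, map_mul,
      Multiset.card_cons] at ih ⊢
    rw [ih]
    have h1 : Commute ((-1 : 𝔸) ^ s.card) (a - algebraMap ℂ 𝔸 z) :=
      (Commute.neg_one_left _).pow_left _
    simp only [map_sub, Polynomial.aeval_X, Polynomial.aeval_C, map_neg, pow_succ]
    rw [mul_assoc, neg_one_mul, ← neg_mul, ← mul_assoc, ← mul_assoc]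
    congr 1
    rw [mul_neg, h1.eq, ← neg_mul]
    congr 1
    abel

theorem norm_map_ofReal {d : ℕ} (M : Matrix (Fin d) (Fin d) ℝ) :
    ‖M.map (algebraMap ℝ ℂ)‖ = ‖M‖ := by
  rw [Matrix.linfty_opNorm_def, Matrix.linfty_opNorm_def]
  simp

theorem exp_map_ofReal {d : ℕ} (M : Matrix (Fin d) (Fin d) ℝ) :
    (NormedSpace.exp M).map (algebraMap ℝ ℂ) = NormedSpace.exp (M.map (algebraMap ℝ ℂ)) := by
  have hc : Continuous ((algebraMap ℝ ℂ).mapMatrix : Matrix (Fin d) (Fin d) ℝ →+* _) :=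
    continuous_id.matrix_map Complex.continuous_ofReal
  exact NormedSpace.map_exp ((algebraMap ℝ ℂ).mapMatrix : Matrix (Fin d) (Fin d) ℝ →+* _) hc M

theorem aeval_map_ofReal {d : ℕ} (M : Matrix (Fin d) (Fin d) ℝ) (p : Polynomial ℝ) :
    (Polynomial.aeval M p).map (algebraMap ℝ ℂ) =
      Polynomial.aeval (M.map (algebraMap ℝ ℂ)) (p.map (algebraMap ℝ ℂ)) := by
  refine Polynomial.map_aeval_eq_aeval_map
    (ψ := ((algebraMap ℝ ℂ).mapMatrix : Matrix (Fin d) (Fin d) ℝ →+* _)) ?_ p M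
  ext r i j
  simp [Matrix.algebraMap_matrix_apply]
  split_ifs <;> simp

variable {d : ℕ}

/-- The flow `e^{tA}` of the uncontrolled system. -/
def flow (A : Matrix (Fin d) (Fin d) ℝ) (t : ℝ) : Matrix (Fin d) (Fin d) ℝ :=
  NormedSpace.exp (t • A)

theorem flow_zero (A : Matrix (Fin d) (Fin d) ℝ) : flow A 0 = 1 := by simp [flow]

theorem flow_add (A : Matrix (Fin d) (Fin d) ℝ) (s t : ℝ) :
    flow A (s + t) = flow A s * flow A t := by
  rw [flow, add_smul, Matrix.exp_add_of_commute _ _ (((Commute.refl A).smul_left s).smul_right t)]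
  rfl

theorem flow_mul_flow_neg (A : Matrix (Fin d) (Fin d) ℝ) (t : ℝ) :
    flow A t * flow A (-t) = 1 := by
  rw [← flow_add, add_neg_cancel, flow_zero]

theorem flow_neg_mul_flow (A : Matrix (Fin d) (Fin d) ℝ) (t : ℝ) :
    flow A (-t) * flow A t = 1 := by
  rw [← flow_add, neg_add_cancel, flow_zero]

theorem hasDerivAt_flow (A : Matrix (Fin d) (Fin d) ℝ) (t : ℝ) :
    HasDerivAt (flow A) (A * flow A t) t :=
  hasDerivAt_exp_smul A t

theorem continuous_flow (A : Matrix (Fin d) (Fin d) ℝ) : Continuous (flow A) :=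
  continuous_iff_continuousAt.2 fun t => (hasDerivAt_flow A t).continuousAt

theorem commute_flow {A P : Matrix (Fin d) (Fin d) ℝ} (h : Commute A P) (t : ℝ) :
    Commute (flow A t) P := by
  have : Commute (t • A) P := h.smul_left t
  exact this.exp_left

/-- An exponential dichotomy: `P` is the projection onto the unstable subspace along the
stable one. -/
structure IsDichotomy (A P : Matrix (Fin d) (Fin d) ℝ) (C α : ℝ) : Prop where
  idem : P * P = P
  comm : Commute A P
  trace_eq : (A * P).trace = ((eigenvalues A).map fun μ : ℂ => max 0 μ.re).sum
  const_pos : 0 < C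
  rate_pos : 0 < α
  stable_le : ∀ t : ℝ, 0 ≤ t → ‖flow A t * (1 - P)‖ ≤ C * Real.exp (-α * t)
  unstable_le : ∀ t : ℝ, 0 ≤ t → ‖flow A (-t) * P‖ ≤ C * Real.exp (-α * t)

theorem eigenvalues_map_conj (A : Matrix (Fin d) (Fin d) ℝ) :
    (eigenvalues A).map (starRingEnd ℂ) = eigenvalues A := by
  have h : (A.map (algebraMap ℝ ℂ)).charpoly = A.charpoly.map (algebraMap ℝ ℂ) :=
    Matrix.charpoly_map A (algebraMap ℝ ℂ)
  have h2 : (A.map (algebraMap ℝ ℂ)).charpoly.map (starRingEnd ℂ) =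
      (A.map (algebraMap ℝ ℂ)).charpoly := by
    rw [h, Polynomial.map_map]
    congr 1
    ext r
    simp
  rw [eigenvalues, ← (IsAlgClosed.splits _).roots_map, h2]

theorem exists_pos_lt_of_multiset (s : Multiset ℝ) (hs : ∀ x ∈ s, 0 < x) :
    ∃ α : ℝ, 0 < α ∧ ∀ x ∈ s, α < x := by
  induction s using Multiset.induction with
  | empty => exact ⟨1, one_pos, by simp⟩
  | cons a s ih =>
    obtain ⟨α, h0, h⟩ := ih fun x hx => hs x (by simp [hx])
    have ha := hs a (by simp)
    refine ⟨min α (a / 2), by positivity, fun x hx => ?_⟩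
    rcases Multiset.mem_cons.1 hx with rfl | hx
    · exact (min_le_right _ _).trans_lt (by linarith)
    · exact (min_le_left _ _).trans_lt (h x hx)

/-- Split the characteristic polynomial as `ps * pu` by the sign of the real part. Bézout gives a·ps
+ b·pu = 1, and P = (a·ps)(A). By Cayley–Hamilton, `pu` annihilates P and `ps` annihilates 1 - P,
which yields idempotence and both decay estimates. -/
theorem exists_isDichotomy (A : Matrix (Fin d) (Fin d) ℝ) (hA : IsHyperbolic A) :
    ∃ P C α, IsDichotomy A P C α := by
  set Ac := A.map (algebraMap ℝ ℂ) with hAc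
  set R := eigenvalues A with hR
  have hconj := eigenvalues_map_conj A
  -- The rate lies strictly below every |Re z|, as the decay lemma needs a strict gap.
  obtain ⟨α, hα0, hα⟩ := exists_pos_lt_of_multiset (R.map fun z => |z.re|) (by
    intro x hx
    obtain ⟨z, hz, rfl⟩ := Multiset.mem_map.1 hx
    exact abs_pos.2 (hA z hz))
  replace hα : ∀ z ∈ R, α < |z.re| := fun z hz => hα _ (Multiset.mem_map_of_mem _ hz)
  obtain ⟨ps, hps⟩ := exists_real_map_eq_rootPolynomial (R.filter fun z => z.re < 0) (by
    conv_rhs => rw [hR, ← hconj]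
    rw [Multiset.filter_map]
    congr 1)
  obtain ⟨pu, hpu⟩ := exists_real_map_eq_rootPolynomial (R.filter fun z => ¬ z.re < 0) (by
    conv_rhs => rw [hR, ← hconj]
    rw [Multiset.filter_map]
    congr 1)
  have hinj : Function.Injective (algebraMap ℝ ℂ) := (algebraMap ℝ ℂ).injective
  have hsu : ps * pu = A.charpoly := by
    apply Polynomial.map_injective _ hinj
    rw [Polynomial.map_mul, hps, hpu, ← Matrix.charpoly_map A (algebraMap ℝ ℂ), rootPolynomial,
      rootPolynomial, ← Multiset.prod_add, ← Multiset.map_add, Multiset.filter_add_not]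
    exact ((IsAlgClosed.splits Ac.charpoly).eq_prod_roots_of_monic Ac.charpoly_monic).symm
  have hcop : IsCoprime ps pu := by
    rw [← Polynomial.isCoprime_map (algebraMap ℝ ℂ), hps, hpu,
      Polynomial.isCoprime_iff_aeval_ne_zero_of_isAlgClosed (K := ℂ) (k := ℂ)]
    intro z
    by_contra! h
    simp only [Polynomial.coe_aeval_eq_eval, rootPolynomial_eval_eq_zero_iff,
      Multiset.mem_filter] at h
    exact absurd h.1.2 (not_lt.2 h.2.2)
  obtain ⟨a, b, hab⟩ := hcop
  set P := Polynomial.aeval A (a * ps) with hP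
  have h1P : 1 - P = Polynomial.aeval A (b * pu) := by
    rw [hP, sub_eq_iff_eq_add, ← map_add, add_comm, hab, map_one]
  have hCH : Polynomial.aeval A (ps * pu) = 0 := by
    rw [hsu, Matrix.aeval_self_charpoly]
  have hP1 : P * (1 - P) = 0 := by
    rw [h1P, hP, ← map_mul, show a * ps * (b * pu) = (a * b) * (ps * pu) by ring, map_mul, hCH,
      mul_zero]
  have hcompl : ∀ p q : Polynomial ℝ, ps * pu ∣ p * q →
      Polynomial.aeval Ac (p.map (algebraMap ℝ ℂ)) *
        (Polynomial.aeval A q).map (algebraMap ℝ ℂ) = 0 := by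
    rintro p q ⟨r, hr⟩
    rw [aeval_map_ofReal, ← map_mul, ← Polynomial.map_mul, hr, ← aeval_map_ofReal, map_mul, hCH,
      zero_mul]
    ext; simp
  have hflow : ∀ (M Q : Matrix (Fin d) (Fin d) ℝ) (t : ℝ),
      ‖NormedSpace.exp (t • M) * Q‖ =
      ‖NormedSpace.exp ((t : ℂ) • M.map (algebraMap ℝ ℂ)) * Q.map (algebraMap ℝ ℂ)‖ := by
    intro M Q t
    rw [← norm_map_ofReal, Matrix.map_mul, exp_map_ofReal]
    congr 3
    ext i j
    simp
  obtain ⟨C₁, hC₁, hs⟩ := exists_norm_exp_smul_mul_le Ac α (R.filter fun z => z.re < 0) (by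
    intro z hz
    rw [Multiset.mem_filter] at hz
    have := hα z hz.1
    rw [abs_of_neg hz.2] at this
    linarith) ((1 - P).map (algebraMap ℝ ℂ)) (by
    change Polynomial.aeval Ac (rootPolynomial _) * _ = 0
    rw [← hps, h1P]
    exact hcompl _ _ ⟨b, by ring⟩)
  obtain ⟨C₂, hC₂, hu⟩ := exists_norm_exp_smul_mul_le (-Ac) α
    ((R.filter fun z => ¬ z.re < 0).map fun z => -z) (by
    intro z hz
    obtain ⟨w, hw, rfl⟩ := Multiset.mem_map.1 hz
    rw [Multiset.mem_filter] at hw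
    have := hα w hw.1
    rw [abs_of_nonneg (not_lt.1 hw.2)] at this
    rw [Complex.neg_re]
    linarith) (P.map (algebraMap ℝ ℂ)) (by
    change Polynomial.aeval (-Ac) (rootPolynomial _) * _ = 0
    rw [aeval_neg_rootPolynomial, ← hpu, mul_assoc, hP, hcompl _ _ ⟨a, by ring⟩, mul_zero])
  refine ⟨P, C₁ + C₂ + 1, α, ?_, ?_, ?_, by positivity, hα0, ?_, ?_⟩
  · rw [mul_sub, mul_one, sub_eq_zero] at hP1
    exact hP1.symm
  · have h := (Polynomial.commute_X (a * ps)).map (Polynomial.aeval A)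
    rwa [Polynomial.aeval_X] at h
  · have h1 : (((A * P).trace : ℝ) : ℂ) = (R.map fun z => if z.re < 0 then 0 else z).sum := by
      have h2 : A * P = Polynomial.aeval A (Polynomial.X * (a * ps)) := by
        rw [map_mul, Polynomial.aeval_X]
      have h3 : (((A * P).trace : ℝ) : ℂ) = ((A * P).map (algebraMap ℝ ℂ)).trace := by
        simp [Matrix.trace]
      rw [h3, h2, aeval_map_ofReal, trace_aeval]
      -- By Bézout, `a * ps` is 0 at the eigenvalues with negative real part and 1 at the others.
      refine congrArg Multiset.sum (Multiset.map_congr rfl fun z hz => ?_)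
      have hz' : z ∈ R := hz
      have h4 := congrArg (fun p => (p.map (algebraMap ℝ ℂ)).eval z) hab
      simp only [Polynomial.map_add, Polynomial.map_mul, Polynomial.eval_add, Polynomial.eval_mul,
        Polynomial.map_one, Polynomial.eval_one, hps, hpu] at h4
      simp only [Polynomial.map_mul, Polynomial.eval_mul, Polynomial.map_X, Polynomial.eval_X, hps]
      split_ifs with hre
      · rw [(rootPolynomial_eval_eq_zero_iff _ z).2 (by simp [hz', hre])]
        ring
      · rw [(rootPolynomial_eval_eq_zero_iff (R.filter fun z => ¬ z.re < 0) z).2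
          (by rw [Multiset.mem_filter]; exact ⟨hz', hre⟩), mul_zero, add_zero] at h4
        rw [h4, mul_one]
    have h5 := congrArg Complex.reAddGroupHom h1
    rw [map_multiset_sum, Multiset.map_map] at h5
    refine (show (A * P).trace = _ from h5).trans
      (congrArg Multiset.sum (Multiset.map_congr rfl fun z _ => ?_))
    simp only [Function.comp_apply, Complex.coe_reAddGroupHom]
    split_ifs with hre
    · rw [max_eq_left hre.le, Complex.zero_re]
    · rw [max_eq_right (not_lt.1 hre)]
  · intro t ht
    rw [flow, hflow]
    refine (hs t ht).trans ?_
    gcongr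
    linarith
  · intro t ht
    rw [flow, neg_smul, ← smul_neg, hflow]
    have : (-A).map (algebraMap ℝ ℂ) = -Ac := by ext; simp [hAc]
    rw [this]
    refine (hu t ht).trans ?_
    gcongr
    linarith

/-- A vector fixed by e^{TA} is fixed by all its positive and negative powers; the former contract
its stable component to 0 and the latter its unstable component. -/
theorem IsDichotomy.flow_mulVec_eq_self {A P : Matrix (Fin d) (Fin d) ℝ} {C α : ℝ}
    (h : IsDichotomy A P C α) {T : ℝ} (hT : 0 < T) {v : Fin d → ℝ} (hv : flow A T *ᵥ v = v) :
    v = 0 := by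
  have hpos : ∀ n : ℕ, flow A (n * T) *ᵥ v = v := by
    intro n
    induction n with
    | zero => simp [flow_zero]
    | succ n ih =>
      rw [Nat.cast_succ, add_mul, one_mul, flow_add, ← Matrix.mulVec_mulVec, hv, ih]
  have hneg : ∀ n : ℕ, flow A (-(n * T)) *ᵥ v = v := by
    intro n
    conv_lhs => rw [← hpos n]
    rw [Matrix.mulVec_mulVec, flow_neg_mul_flow, Matrix.one_mulVec]
  have hlim : Tendsto (fun n : ℕ => C * Real.exp (-α * (n * T)) * ‖v‖) atTop (𝓝 0) := by
    have h1 : Tendsto (fun n : ℕ => α * T * (n : ℝ)) atTop atTop :=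
      tendsto_natCast_atTop_atTop.const_mul_atTop (mul_pos h.rate_pos hT)
    have h2 := ((Real.tendsto_exp_neg_atTop_nhds_zero.comp h1).const_mul C).mul_const ‖v‖
    simp only [mul_zero, zero_mul] at h2
    refine h2.congr fun n => ?_
    simp only [Function.comp_apply]
    congr 3
    ring
  have hP : P *ᵥ v = 0 := by
    rw [← norm_le_zero_iff]
    refine ge_of_tendsto hlim (Eventually.of_forall fun n => ?_)
    have h1 : P *ᵥ v = (flow A (-(n * T)) * P) *ᵥ v := by
      rw [(commute_flow h.comm _).eq, ← Matrix.mulVec_mulVec, hneg]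
    rw [h1]
    refine (Matrix.linfty_opNorm_mulVec _ _).trans ?_
    gcongr
    exact h.unstable_le _ (by positivity)
  have hQ : (1 - P) *ᵥ v = 0 := by
    rw [← norm_le_zero_iff]
    refine ge_of_tendsto hlim (Eventually.of_forall fun n => ?_)
    have h1 : (1 - P) *ᵥ v = (flow A (n * T) * (1 - P)) *ᵥ v := by
      rw [(commute_flow ((Commute.one_right A).sub_right h.comm) _).eq, ← Matrix.mulVec_mulVec,
        hpos]
    rw [h1]
    refine (Matrix.linfty_opNorm_mulVec _ _).trans ?_
    gcongr
    exact h.stable_le _ (by positivity)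
  rw [Matrix.sub_mulVec, Matrix.one_mulVec, hP, sub_zero] at hQ
  exact hQ

theorem IsDichotomy.isUnit_one_sub_flow {A P : Matrix (Fin d) (Fin d) ℝ} {C α : ℝ}
    (h : IsDichotomy A P C α) {T : ℝ} (hT : 0 < T) : IsUnit (1 - flow A T) := by
  rw [← Matrix.mulVec_injective_iff_isUnit]
  intro v w hvw
  refine sub_eq_zero.1 (h.flow_mulVec_eq_self hT ?_)
  have : (1 - flow A T) *ᵥ (v - w) = 0 := by
    rw [Matrix.mulVec_sub]
    exact sub_eq_zero.2 hvw
  rw [Matrix.sub_mulVec, Matrix.one_mulVec, sub_eq_zero] at this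
  exact this.symm

end

/-! ### Variation of constants and concatenation of controls -/

section

variable {d m : ℕ}

theorem intervalIntegrable_of_locallyIntegrable {E : Type*} [NormedAddCommGroup E] {f : ℝ → E}
    (hf : LocallyIntegrable f volume) (a b : ℝ) : IntervalIntegrable f volume a b :=
  intervalIntegrable_iff.mpr
    ((hf.integrableOn_isCompact isCompact_uIcc).mono_set Set.uIoc_subset_uIcc)

theorem intervalIntegrable_pi {n : ℕ} {f : ℝ → Fin n → ℝ} {a b : ℝ} :
    IntervalIntegrable f volume a b ↔ ∀ i, IntervalIntegrable (fun s => f s i) volume a b := by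
  simp only [intervalIntegrable_iff, IntegrableOn, integrable_pi_iff]

theorem intervalIntegral_apply {n : ℕ} {f : ℝ → Fin n → ℝ} {a b : ℝ}
    (hf : IntervalIntegrable f volume a b) (i : Fin n) :
    (∫ s in a..b, f s) i = ∫ s in a..b, f s i :=
  ((ContinuousLinearMap.proj (R := ℝ) (φ := fun _ : Fin n => ℝ) i).intervalIntegral_comp_comm
    hf).symm

theorem intervalIntegrable_mulVec {k n : ℕ} {M : ℝ → Matrix (Fin k) (Fin n) ℝ} (hM : Continuous M)
    {g : ℝ → Fin n → ℝ} {a b : ℝ} (hg : IntervalIntegrable g volume a b) :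
    IntervalIntegrable (fun s => M s *ᵥ g s) volume a b := by
  rw [intervalIntegrable_pi] at hg ⊢
  intro i
  simp only [Matrix.mulVec, dotProduct]
  have := IntervalIntegrable.sum (μ := volume) (a := a) (b := b) Finset.univ
    (f := fun j s => M s i j * g s j)
    (fun j _ => (hg j).continuousOn_mul (hM.matrix_elem i j).continuousOn)
  convert! this using 1
  ext s
  simp

theorem integral_const_mulVec {k n : ℕ} (M : Matrix (Fin k) (Fin n) ℝ)
    {g : ℝ → Fin n → ℝ} {a b : ℝ} (hg : IntervalIntegrable g volume a b) :
    ∫ s in a..b, M *ᵥ g s = M *ᵥ ∫ s in a..b, g s :=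
  (M.mulVecLin.toContinuousLinearMap).intervalIntegral_comp_comm hg

/-- Controls are only measurable, so the primitive of g is merely absolutely continuous and
differentiable almost everywhere; this form of integration by parts is what Carathéodory solutions
require. -/
theorem integral_mul_eq_parts {u u' : ℝ → ℝ} (hu : ∀ t, HasDerivAt u (u' t) t)
    (hu' : Continuous u') {g : ℝ → ℝ} (hg : ∀ a b, IntervalIntegrable g volume a b) (t : ℝ) :
    ∫ s in (0 : ℝ)..t, u s * g s =
      u t * (∫ s in (0 : ℝ)..t, g s) - ∫ s in (0 : ℝ)..t, u' s * ∫ r in (0 : ℝ)..s, g r := by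
  have hderiv : deriv u = u' := funext fun s => (hu s).deriv
  have h1 : AbsolutelyContinuousOnInterval u 0 t := by
    refine (ContDiff.contDiffOn ?_).absolutelyContinuousOnInterval
    rw [contDiff_one_iff_deriv]
    exact ⟨fun s => (hu s).differentiableAt, hderiv ▸ hu'⟩
  have h2 : AbsolutelyContinuousOnInterval (fun s => ∫ r in (0 : ℝ)..s, g r) 0 t :=
    (hg 0 t).absolutelyContinuousOnInterval_intervalIntegral (by simp)
  have h3 := h1.integral_mul_deriv_eq_deriv_mul h2
  rw [hderiv] at h3
  simp only [intervalIntegral.integral_same, mul_zero, sub_zero] at h3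
  rw [← h3]
  refine intervalIntegral.integral_congr_ae ?_
  filter_upwards [(hg 0 t).ae_hasDerivAt_integral] with s hs hst
  rw [(hs (Set.uIoc_subset_uIcc hst) 0 (by simp)).deriv]

theorem continuous_primitive_of_intervalIntegrable {n : ℕ} {g : ℝ → Fin n → ℝ}
    (hg : ∀ a b, IntervalIntegrable g volume a b) :
    Continuous fun t => ∫ s in (0 : ℝ)..t, g s :=
  intervalIntegral.continuous_primitive hg 0

theorem integral_mulVec_eq_parts {k n : ℕ} {M M' : ℝ → Matrix (Fin k) (Fin n) ℝ}
    (hM : ∀ t, HasDerivAt M (M' t) t) (hM' : Continuous M') {g : ℝ → Fin n → ℝ}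
    (hg : ∀ a b, IntervalIntegrable g volume a b) (t : ℝ) :
    ∫ s in (0 : ℝ)..t, M s *ᵥ g s =
      M t *ᵥ (∫ s in (0 : ℝ)..t, g s) -
        ∫ s in (0 : ℝ)..t, M' s *ᵥ ∫ r in (0 : ℝ)..s, g r := by
  have hMc : Continuous M := continuous_iff_continuousAt.2 fun t => (hM t).continuousAt
  have hG := continuous_primitive_of_intervalIntegrable hg
  have hMG : Continuous fun s => M' s *ᵥ ∫ r in (0 : ℝ)..s, g r := hM'.matrix_mulVec hG
  have hij : ∀ i j t, HasDerivAt (fun s => M s i j) (M' t i j) t := fun i j t =>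
    ((Matrix.entryLinearMap ℝ ℝ i j).toContinuousLinearMap.hasFDerivAt).comp_hasDerivAt t (hM t)
  have hgi := fun a b => intervalIntegrable_pi.1 (hg a b)
  have hGi : ∀ s j, (∫ r in (0 : ℝ)..s, g r) j = ∫ r in (0 : ℝ)..s, g r j := fun s j =>
    intervalIntegral_apply (hg 0 s) j
  ext i
  rw [intervalIntegral_apply (intervalIntegrable_mulVec hMc (hg 0 t)), Pi.sub_apply,
    intervalIntegral_apply (hMG.intervalIntegrable 0 t)]
  simp only [Matrix.mulVec, dotProduct, hGi]
  rw [intervalIntegral.integral_finsetSum, intervalIntegral.integral_finsetSum,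
    ← Finset.sum_sub_distrib]
  · exact Finset.sum_congr rfl fun j _ => integral_mul_eq_parts (hij i j) (hM'.matrix_elem i j)
      (fun a b => hgi a b j) t
  · intro j _
    refine Continuous.intervalIntegrable ?_ 0 t
    refine (hM'.matrix_elem i j).mul ?_
    simp_rw [← hGi]
    exact (continuous_apply j).comp hG
  · exact fun j _ => (hgi 0 t j).continuousOn_mul (hMc.matrix_elem i j).continuousOn

theorem hasDerivAt_mulVec_const {k n : ℕ} {M : ℝ → Matrix (Fin k) (Fin n) ℝ}
    {M' : Matrix (Fin k) (Fin n) ℝ} {t : ℝ} (h : HasDerivAt M M' t) (x : Fin n → ℝ) :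
    HasDerivAt (fun s => M s *ᵥ x) (M' *ᵥ x) t := by
  let L : Matrix (Fin k) (Fin n) ℝ →ₗ[ℝ] (Fin k → ℝ) :=
    { toFun := fun M => M *ᵥ x
      map_add' := fun M N => Matrix.add_mulVec M N x
      map_smul' := fun c M => Matrix.smul_mulVec c M x }
  exact (L.toContinuousLinearMap.hasFDerivAt (x := M t)).comp_hasDerivAt t h

/-- The solution of the control system, by variation of constants. -/
def sol (A : Matrix (Fin d) (Fin d) ℝ) (B : Matrix (Fin d) (Fin m) ℝ) (x : Fin d → ℝ)
    (ω : ℝ → Fin m → ℝ) (t : ℝ) : Fin d → ℝ :=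
  flow A t *ᵥ (x + ∫ s in (0 : ℝ)..t, flow A (-s) *ᵥ (B *ᵥ ω s))

theorem hasDerivAt_flow_neg (A : Matrix (Fin d) (Fin d) ℝ) (t : ℝ) :
    HasDerivAt (fun s => flow A (-s)) (-(flow A (-t) * A)) t := by
  have h := (hasDerivAt_flow A (-t)).scomp t (hasDerivAt_neg t)
  rw [(commute_flow (Commute.refl A) (-t)).eq]
  rw [neg_smul, one_smul] at h
  exact h

theorem continuous_flow_neg (A : Matrix (Fin d) (Fin d) ℝ) : Continuous fun s => flow A (-s) :=
  (continuous_flow A).comp continuous_neg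

section

variable (A : Matrix (Fin d) (Fin d) ℝ) (B : Matrix (Fin d) (Fin m) ℝ) (x : Fin d → ℝ)
  {ω : ℝ → Fin m → ℝ} (hω : ∀ a b, IntervalIntegrable ω volume a b)

theorem integral_flow_mulVec (t : ℝ) :
    ∫ s in (0 : ℝ)..t, (A * flow A s) *ᵥ x = flow A t *ᵥ x - x := by
  have h : ∀ s, HasDerivAt (fun s => flow A s *ᵥ x) ((A * flow A s) *ᵥ x) s := fun s =>
    hasDerivAt_mulVec_const (hasDerivAt_flow A s) x
  rw [intervalIntegral.integral_eq_sub_of_hasDerivAt (fun s _ => h s), flow_zero,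
    Matrix.one_mulVec]
  exact ((continuous_const.mul (continuous_flow A)).matrix_mulVec continuous_const).intervalIntegrable
    0 t

include hω

theorem intervalIntegrable_flow_neg_mulVec (a b : ℝ) :
    IntervalIntegrable (fun s => flow A (-s) *ᵥ (B *ᵥ ω s)) volume a b :=
  intervalIntegrable_mulVec (continuous_flow_neg A)
    (intervalIntegrable_mulVec continuous_const (hω a b))

theorem continuous_sol : Continuous (sol A B x ω) :=
  (continuous_flow A).matrix_mulVec (continuous_const.add
    (continuous_primitive_of_intervalIntegrable (intervalIntegrable_flow_neg_mulVec A B hω)))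

theorem isTrajectory_sol : IsTrajectory A B ω x (sol A B x ω) := by
  refine ⟨continuous_sol A B x hω, fun t => ?_⟩
  set h : ℝ → Fin d → ℝ := fun s => flow A (-s) *ᵥ (B *ᵥ ω s) with hh
  have hhi : ∀ a b, IntervalIntegrable h volume a b := intervalIntegrable_flow_neg_mulVec A B hω
  have hH := continuous_primitive_of_intervalIntegrable hhi
  have hM' : Continuous fun s => A * flow A s := continuous_const.mul (continuous_flow A)
  have hp := integral_mulVec_eq_parts (hasDerivAt_flow A) hM' hhi t
  have h1 : ∀ s, flow A s *ᵥ h s = B *ᵥ ω s := fun s => by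
    rw [hh, Matrix.mulVec_mulVec, flow_mul_flow_neg, Matrix.one_mulVec]
  simp only [h1] at hp
  have h2 : ∀ s, A *ᵥ sol A B x ω s =
      (A * flow A s) *ᵥ x + (A * flow A s) *ᵥ ∫ r in (0 : ℝ)..s, h r := fun s => by
    rw [sol, Matrix.mulVec_mulVec, Matrix.mulVec_add]
  rw [intervalIntegral.integral_add
    ((continuous_const.matrix_mulVec (continuous_sol A B x hω)).intervalIntegrable 0 t)
    (intervalIntegrable_mulVec continuous_const (hω 0 t)), hp]
  simp only [h2]
  rw [intervalIntegral.integral_add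
    ((hM'.matrix_mulVec continuous_const).intervalIntegrable 0 t)
    ((hM'.matrix_mulVec hH).intervalIntegrable 0 t), integral_flow_mulVec, sol, Matrix.mulVec_add]
  abel

/-- Uniqueness without Gronwall: integrating e^{-sA}ξ'(s) by parts cancels the terms in Aξ and
leaves e^{-tA}ξ(t) expressed through the control alone. -/
theorem IsTrajectory.eq_sol {A B x} {ξ : ℝ → Fin d → ℝ} (hξ : IsTrajectory A B ω x ξ) :
    ξ = sol A B x ω := by
  obtain ⟨hc, hξ⟩ := hξ
  funext t
  set g : ℝ → Fin d → ℝ := fun s => A *ᵥ ξ s + B *ᵥ ω s with hg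
  have hAξ : Continuous fun s => A *ᵥ ξ s := continuous_const.matrix_mulVec hc
  have hBω : ∀ a b, IntervalIntegrable (fun s => B *ᵥ ω s) volume a b := fun a b =>
    intervalIntegrable_mulVec continuous_const (hω a b)
  have hgi : ∀ a b, IntervalIntegrable g volume a b := fun a b =>
    (hAξ.intervalIntegrable a b).add (hBω a b)
  have hG : ∀ s, ∫ r in (0 : ℝ)..s, g r = ξ s - x := fun s => by
    rw [hξ s]; abel
  have hM' : Continuous fun s => -(flow A (-s) * A) :=
    ((continuous_flow_neg A).mul continuous_const).neg
  have hp := integral_mulVec_eq_parts (hasDerivAt_flow_neg A) hM' hgi t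
  simp only [hG] at hp
  have h1 : ∫ s in (0 : ℝ)..t, flow A (-s) *ᵥ g s = (∫ s in (0 : ℝ)..t, flow A (-s) *ᵥ (A *ᵥ ξ s)) +
      ∫ s in (0 : ℝ)..t, flow A (-s) *ᵥ (B *ᵥ ω s) := by
    rw [← intervalIntegral.integral_add
      (((continuous_flow_neg A).matrix_mulVec hAξ).intervalIntegrable 0 t)
      (intervalIntegrable_flow_neg_mulVec A B hω 0 t)]
    simp only [hg, Matrix.mulVec_add]
  have h2 : ∫ s in (0 : ℝ)..t, -(flow A (-s) * A) *ᵥ (ξ s - x) =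
      -(∫ s in (0 : ℝ)..t, flow A (-s) *ᵥ (A *ᵥ ξ s)) - (flow A (-t) *ᵥ x - x) := by
    have h3 : ∫ s in (0 : ℝ)..t, -(flow A (-s) * A) *ᵥ x = flow A (-t) *ᵥ x - x := by
      have h : ∀ s, HasDerivAt (fun s => flow A (-s) *ᵥ x) (-(flow A (-s) * A) *ᵥ x) s := fun s =>
        hasDerivAt_mulVec_const (hasDerivAt_flow_neg A s) x
      rw [intervalIntegral.integral_eq_sub_of_hasDerivAt (fun s _ => h s), neg_zero, flow_zero,
        Matrix.one_mulVec]
      exact (hM'.matrix_mulVec continuous_const).intervalIntegrable 0 t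
    simp only [Matrix.mulVec_sub]
    rw [intervalIntegral.integral_sub ((hM'.matrix_mulVec hc).intervalIntegrable 0 t)
      ((hM'.matrix_mulVec continuous_const).intervalIntegrable 0 t), h3,
      ← intervalIntegral.integral_neg]
    simp only [Matrix.neg_mulVec, Matrix.mulVec_mulVec]
  rw [h1, h2, Matrix.mulVec_sub] at hp
  have h4 : x + ∫ s in (0 : ℝ)..t, flow A (-s) *ᵥ (B *ᵥ ω s) = flow A (-t) *ᵥ ξ t := by
    have h5 := sub_eq_zero.2 hp
    rw [← sub_eq_zero, ← h5]
    abel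
  rw [sol, h4, Matrix.mulVec_mulVec, flow_mul_flow_neg, Matrix.one_mulVec]

theorem isTrajectory_iff {ξ : ℝ → Fin d → ℝ} : IsTrajectory A B ω x ξ ↔ ξ = sol A B x ω :=
  ⟨fun h => h.eq_sol hω, fun h => h ▸ isTrajectory_sol A B x hω⟩

theorem sol_add (s t : ℝ) :
    sol A B x ω (s + t) = sol A B (sol A B x ω s) (fun r => ω (s + r)) t := by
  have hi := intervalIntegrable_flow_neg_mulVec A B hω
  have h1 : ∫ r in (0 : ℝ)..t, flow A (-r) *ᵥ (B *ᵥ ω (s + r)) =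
      flow A s *ᵥ ∫ r in s..(s + t), flow A (-r) *ᵥ (B *ᵥ ω r) := by
    rw [← integral_const_mulVec _ (hi _ _)]
    have := intervalIntegral.integral_comp_add_left (a := 0) (b := t)
      (fun r => flow A s *ᵥ (flow A (-r) *ᵥ (B *ᵥ ω r))) s
    rw [add_zero] at this
    rw [← this]
    congr 1
    ext1 r
    rw [Matrix.mulVec_mulVec _ (flow A s), ← flow_add]
    congr 2
    ring
  simp only [sol]
  rw [h1, ← Matrix.mulVec_add, Matrix.mulVec_mulVec, ← flow_add, add_comm t s, add_assoc,
    intervalIntegral.integral_add_adjacent_intervals (hi _ _) (hi _ _)]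

end

section

variable (A : Matrix (Fin d) (Fin d) ℝ) (B : Matrix (Fin d) (Fin m) ℝ) (x : Fin d → ℝ)
  (ω : ℝ → Fin m → ℝ)

theorem sol_zero_time : sol A B x ω 0 = x := by simp [sol, flow_zero]

theorem sol_eq_flow_add (t : ℝ) : sol A B x ω t = flow A t *ᵥ x + sol A B 0 ω t := by
  simp [sol, Matrix.mulVec_add]

theorem sol_zero_control (t : ℝ) : sol A B x 0 t = flow A t *ᵥ x := by
  simp [sol]

theorem continuous_sol_initial (t : ℝ) : Continuous fun x => sol A B x ω t :=
  continuous_const.matrix_mulVec (continuous_id.add continuous_const)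

theorem sol_congr {ω' : ℝ → Fin m → ℝ} {t : ℝ} (ht : 0 ≤ t)
    (h : ∀ s, 0 < s → s ≤ t → ω s = ω' s) : sol A B x ω t = sol A B x ω' t := by
  rw [sol, sol]
  congr 2
  refine intervalIntegral.integral_congr_ae (Eventually.of_forall fun s hs => ?_)
  rw [Set.uIoc_of_le ht] at hs
  rw [h s hs.1 hs.2]

end

/-- The control that follows `ω` up to time `T` and `ω'` afterwards. -/
def concat (T : ℝ) (ω ω' : ℝ → Fin m → ℝ) : ℝ → Fin m → ℝ :=
  fun s => if s ≤ T then ω s else ω' (s - T)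

section controls

variable {U : Set (Fin m → ℝ)}

theorem intervalIntegrable_of_mem_controls (hU : Bornology.IsBounded U) {ω : ℝ → Fin m → ℝ}
    (hω : ω ∈ controls U) (a b : ℝ) : IntervalIntegrable ω volume a b := by
  obtain ⟨R, hR⟩ := hU.exists_norm_le
  rw [intervalIntegrable_iff]
  exact Measure.integrableOn_of_bounded (M := R) (by simp) hω.1.aestronglyMeasurable
    (ae_restrict_of_ae (hω.2.mono fun t ht => hR _ ht))

theorem const_mem_controls {u : Fin m → ℝ} (hu : u ∈ U) : (fun _ => u) ∈ controls U :=
  ⟨aemeasurable_const, Eventually.of_forall fun _ => hu⟩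

theorem shift_mem_controls {ω : ℝ → Fin m → ℝ} (hω : ω ∈ controls U) (s : ℝ) :
    (fun r => ω (s + r)) ∈ controls U :=
  ⟨hω.1.comp_quasiMeasurePreserving (measurePreserving_add_left volume s).quasiMeasurePreserving,
    (measurePreserving_add_left volume s).quasiMeasurePreserving.ae hω.2⟩

theorem concat_mem_controls {ω ω' : ℝ → Fin m → ℝ} (hω : ω ∈ controls U)
    (hω' : ω' ∈ controls U) (T : ℝ) : concat T ω ω' ∈ controls U := by
  have h' : (fun s => ω' (s - T)) ∈ controls U := by
    convert! shift_mem_controls hω' (-T) using 3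
    ring
  constructor
  · obtain ⟨g, hg, hωg⟩ := hω.1
    obtain ⟨g', hg', hωg'⟩ := h'.1
    refine ⟨fun s => if s ≤ T then g s else g' s, Measurable.ite measurableSet_Iic hg hg', ?_⟩
    filter_upwards [hωg, hωg'] with s h1 h2
    simp only [concat, h1, h2]
  · filter_upwards [hω.2, h'.2] with s h1 h2
    rw [concat]
    split_ifs
    exacts [h1, h2]

end controls

section

variable (A : Matrix (Fin d) (Fin d) ℝ) (B : Matrix (Fin d) (Fin m) ℝ) (x : Fin d → ℝ)
  {U : Set (Fin m → ℝ)} (hU : Bornology.IsBounded U) {ω ω' : ℝ → Fin m → ℝ}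

theorem sol_concat_of_le {T t : ℝ} (ht : 0 ≤ t) (htT : t ≤ T) :
    sol A B x (concat T ω ω') t = sol A B x ω t :=
  sol_congr A B x _ ht fun s _ hs => by rw [concat, if_pos (hs.trans htT)]

include hU in
theorem sol_concat_add (hω : ω ∈ controls U) (hω' : ω' ∈ controls U) {T t : ℝ} (hT : 0 ≤ T)
    (ht : 0 ≤ t) :
    sol A B x (concat T ω ω') (T + t) = sol A B (sol A B x ω T) ω' t := by
  rw [sol_add A B x (intervalIntegrable_of_mem_controls hU (concat_mem_controls hω hω' T)),
    sol_concat_of_le A B x hT le_rfl]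
  refine sol_congr A B _ _ ht fun s hs _ => ?_
  rw [concat, if_neg (by linarith), add_sub_cancel_left]

end

end

/-! ### Local controllability by small controls -/

section

variable {d m : ℕ} {A : Matrix (Fin d) (Fin d) ℝ} {B : Matrix (Fin d) (Fin m) ℝ}

theorem continuous_flow_neg_mul : Continuous fun s => flow A (-s) * B :=
  (continuous_flow_neg A).matrix_mul continuous_const

/-- The output is real analytic in s, so vanishing on an interval forces vanishing everywhere. Thus
controllability in some unspecified time gives controllability in every time h > 0. -/
theorem eq_zero_of_output_eq_zero {h : ℝ} (hh : 0 < h) (η : Fin d → ℝ)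
    (hη : ∀ s ∈ Set.Icc 0 h, (flow A (-s) * B)ᵀ *ᵥ η = 0) (s : ℝ) :
    (flow A (-s) * B)ᵀ *ᵥ η = 0 := by
  let L : Matrix (Fin d) (Fin d) ℝ →ₗ[ℝ] (Fin m → ℝ) :=
    { toFun := fun M => (M * B)ᵀ *ᵥ η
      map_add' := fun M N => by rw [Matrix.add_mul, Matrix.transpose_add, Matrix.add_mulVec]
      map_smul' := fun c M => by
        rw [Matrix.smul_mul, Matrix.transpose_smul, Matrix.smul_mulVec]; rfl }
  let M : Matrix (Fin d) (Fin d) ℝ →L[ℝ] (Fin m → ℝ) := L.toContinuousLinearMap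
  let J : ℝ →L[ℝ] Matrix (Fin d) (Fin d) ℝ := ContinuousLinearMap.toSpanSingleton ℝ (-A)
  have hJ : ∀ s, NormedSpace.exp (J s) = flow A (-s) := fun s => by
    rw [flow, neg_smul, ← smul_neg]; rfl
  have han : AnalyticOnNhd ℝ (fun s => M (NormedSpace.exp (J s))) Set.univ := fun s _ =>
    (M.analyticAt _).comp ((NormedSpace.exp_analytic (𝕂 := ℝ) (J s)).comp (J.analyticAt s))
  have hzero : (fun s => M (NormedSpace.exp (J s))) = fun _ => 0 := by
    refine han.eq_of_eventuallyEq analyticOnNhd_const (z₀ := h / 2) ?_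
    filter_upwards [Icc_mem_nhds (half_pos hh) (half_lt_self hh)] with s hs
    rw [hJ]
    exact hη s hs
  have := congrFun hzero s
  rw [hJ] at this
  exact this

theorem dotProduct_integral {n : ℕ} (η : Fin n → ℝ) {g : ℝ → Fin n → ℝ} {a b : ℝ}
    (hg : IntervalIntegrable g volume a b) :
    η ⬝ᵥ ∫ s in a..b, g s = ∫ s in a..b, η ⬝ᵥ g s := by
  have hgi := intervalIntegrable_pi.1 hg
  simp only [dotProduct, intervalIntegral_apply hg]
  rw [intervalIntegral.integral_finsetSum fun i _ => (hgi i).const_mul (η i)]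
  simp

/-- Steer η itself to 0: then η equals minus an integral of vectors e^{-sA}Bω(s), all orthogonal to
η, so η·η = 0. -/
theorem output_injective (hAB : IsControllable A B) {h : ℝ} (hh : 0 < h) (η : Fin d → ℝ)
    (hη : ∀ s ∈ Set.Icc 0 h, (flow A (-s) * B)ᵀ *ᵥ η = 0) : η = 0 := by
  have h0 := eq_zero_of_output_eq_zero hh η hη
  obtain ⟨T, -, ω, hω, ξ, hξ, hξT⟩ := hAB η 0
  have hω' := intervalIntegrable_of_locallyIntegrable hω
  rw [hξ.eq_sol hω', sol] at hξT
  have h1 := congrArg (fun v => flow A (-T) *ᵥ v) hξT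
  simp only [Matrix.mulVec_mulVec, flow_neg_mul_flow, Matrix.one_mulVec, Matrix.mulVec_zero] at h1
  have h2 := congrArg (fun v => η ⬝ᵥ v) h1
  simp only [dotProduct_add, dotProduct_zero] at h2
  rw [dotProduct_integral η (intervalIntegrable_mulVec
    continuous_flow_neg_mul (hω' 0 T))] at h2
  have h3 : ∀ s, η ⬝ᵥ (flow A (-s) * B) *ᵥ ω s = 0 := fun s => by
    rw [Matrix.dotProduct_mulVec, ← Matrix.mulVec_transpose, h0 s, zero_dotProduct]
  simp only [h3, intervalIntegral.integral_zero, add_zero] at h2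
  exact dotProduct_self_eq_zero.1 h2

/-- The controllability Gramian. -/
def gramian (A : Matrix (Fin d) (Fin d) ℝ) (B : Matrix (Fin d) (Fin m) ℝ) (h : ℝ) :
    (Fin d → ℝ) →ₗ[ℝ] (Fin d → ℝ) where
  toFun η := ∫ s in (0 : ℝ)..h, (flow A (-s) * B) *ᵥ ((flow A (-s) * B)ᵀ *ᵥ η)
  map_add' η ζ := by
    have hN := continuous_flow_neg_mul (A := A) (B := B)
    have hc : ∀ η : Fin d → ℝ, IntervalIntegrable
        (fun s => (flow A (-s) * B) *ᵥ ((flow A (-s) * B)ᵀ *ᵥ η)) volume 0 h := fun η =>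
      (hN.matrix_mulVec (hN.matrix_transpose.matrix_mulVec continuous_const)).intervalIntegrable 0 h
    rw [← intervalIntegral.integral_add (hc η) (hc ζ)]
    simp only [Matrix.mulVec_add]
  map_smul' c η := by
    simp only [Matrix.mulVec_smul]
    exact intervalIntegral.integral_smul _ _

theorem gramian_injective (hAB : IsControllable A B) {h : ℝ} (hh : 0 < h) :
    Function.Injective (gramian A B h) := by
  rw [← LinearMap.ker_eq_bot, LinearMap.ker_eq_bot']
  intro η hη
  refine output_injective hAB hh η fun s hs => ?_
  by_contra hne
  have hN := continuous_flow_neg_mul (A := A) (B := B)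
  have hc1 : Continuous fun s => (flow A (-s) * B)ᵀ *ᵥ η :=
    hN.matrix_transpose.matrix_mulVec continuous_const
  have hc2 : Continuous fun s => (flow A (-s) * B) *ᵥ ((flow A (-s) * B)ᵀ *ᵥ η) :=
    hN.matrix_mulVec hc1
  have h1 : ∫ s in (0 : ℝ)..h, ((flow A (-s) * B)ᵀ *ᵥ η) ⬝ᵥ ((flow A (-s) * B)ᵀ *ᵥ η) = 0 := by
    have h2 := congrArg (fun v => η ⬝ᵥ v) hη
    simp only [dotProduct_zero] at h2
    change η ⬝ᵥ (∫ s in (0 : ℝ)..h, (flow A (-s) * B) *ᵥ ((flow A (-s) * B)ᵀ *ᵥ η)) = 0 at h2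
    rw [dotProduct_integral η (hc2.intervalIntegrable 0 h)] at h2
    rw [← h2]
    congr 1
    ext s
    rw [Matrix.dotProduct_mulVec η, ← Matrix.mulVec_transpose]
  refine (intervalIntegral.integral_pos hh (hc1.dotProduct hc1).continuousOn ?_ ?_).ne' h1
  · exact fun s _ => dotProduct_self_star_nonneg _
  · refine ⟨s, hs, lt_of_le_of_ne (dotProduct_self_star_nonneg _) (Ne.symm fun h => hne ?_)⟩
    exact dotProduct_self_eq_zero.1 h

/-- The control (e^{-sA}B)ᵀW⁻¹e^{-hA}y, with W the Gramian, reaches y exactly and depends linearly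
on y; it is therefore small when y is. -/
theorem exists_small_control (hAB : IsControllable A B) {h r : ℝ} (hh : 0 < h) (hr : 0 < r) :
    ∃ δ : ℝ, 0 < δ ∧ ∀ y : Fin d → ℝ, ‖y‖ ≤ δ → ∃ v : ℝ → Fin m → ℝ, Measurable v ∧
      (∀ s, ‖v s‖ ≤ r) ∧ sol A B 0 v h = y := by
  have hN := continuous_flow_neg_mul (A := A) (B := B)
  let W : (Fin d → ℝ) ≃ₗ[ℝ] (Fin d → ℝ) :=
    LinearEquiv.ofInjectiveEndo (gramian A B h) (gramian_injective hAB hh)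
  let Wi : (Fin d → ℝ) →L[ℝ] (Fin d → ℝ) := W.symm.toLinearMap.toContinuousLinearMap
  obtain ⟨N₀, hN₀⟩ := (isCompact_Icc (a := (0 : ℝ)) (b := h)).exists_bound_of_continuousOn
    (f := fun s => (flow A (-s) * B)ᵀ) hN.matrix_transpose.continuousOn
  have hN₀0 : 0 ≤ N₀ := (norm_nonneg _).trans (hN₀ 0 ⟨le_rfl, hh.le⟩)
  set c := N₀ * (‖Wi‖ * ‖flow A (-h)‖) with hc
  have hc0 : 0 ≤ c := by positivity
  refine ⟨r / (c + 1), by positivity, fun y hy => ?_⟩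
  set η := Wi (flow A (-h) *ᵥ y) with hη
  have hWη : gramian A B h η = flow A (-h) *ᵥ y := W.apply_symm_apply _
  refine ⟨(Set.Icc 0 h).indicator fun s => (flow A (-s) * B)ᵀ *ᵥ η, ?_, ?_, ?_⟩
  · exact (hN.matrix_transpose.matrix_mulVec continuous_const).measurable.indicator measurableSet_Icc
  · intro s
    by_cases hs : s ∈ Set.Icc 0 h
    · rw [Set.indicator_of_mem hs]
      calc ‖(flow A (-s) * B)ᵀ *ᵥ η‖ ≤ N₀ * (‖Wi‖ * (‖flow A (-h)‖ * ‖y‖)) := by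
            refine (Matrix.linfty_opNorm_mulVec _ _).trans ?_
            gcongr
            · exact hN₀ s hs
            · refine (Wi.le_opNorm _).trans ?_
              gcongr
              exact Matrix.linfty_opNorm_mulVec _ _
        _ = c * ‖y‖ := by rw [hc]; ring
        _ ≤ c * (r / (c + 1)) := by gcongr
        _ ≤ r := by
            rw [mul_div_assoc', div_le_iff₀ (by positivity)]
            nlinarith
    · rw [Set.indicator_of_notMem hs, norm_zero]
      exact hr.le
  · rw [sol_congr A B 0 _ (ω' := fun s => (flow A (-s) * B)ᵀ *ᵥ η) hh.le
      (fun s h0 h1 => Set.indicator_of_mem (Set.mem_Icc.2 ⟨h0.le, h1⟩) _), sol, zero_add]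
    have he : ∫ s in (0 : ℝ)..h, flow A (-s) *ᵥ (B *ᵥ ((flow A (-s) * B)ᵀ *ᵥ η)) =
        gramian A B h η := by
      change _ = ∫ s in (0 : ℝ)..h, (flow A (-s) * B) *ᵥ ((flow A (-s) * B)ᵀ *ᵥ η)
      simp only [Matrix.mulVec_mulVec, Matrix.mul_assoc]
    rw [he, hWη, Matrix.mulVec_mulVec, flow_mul_flow_neg, Matrix.one_mulVec]

/-- `x` is steered to `y` in time `T` by an admissible control. -/
def Steers (A : Matrix (Fin d) (Fin d) ℝ) (B : Matrix (Fin d) (Fin m) ℝ) (U : Set (Fin m → ℝ))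
    (T : ℝ) (x y : Fin d → ℝ) : Prop :=
  0 ≤ T ∧ ∃ ω ∈ controls U, sol A B x ω T = y

variable {U : Set (Fin m → ℝ)}

theorem Steers.trans (hU : Bornology.IsBounded U) {S T : ℝ} {x y z : Fin d → ℝ}
    (h₁ : Steers A B U S x y) (h₂ : Steers A B U T y z) : Steers A B U (S + T) x z := by
  obtain ⟨hS, ω, hω, rfl⟩ := h₁
  obtain ⟨hT, ω', hω', rfl⟩ := h₂
  exact ⟨add_nonneg hS hT, concat S ω ω', concat_mem_controls hω hω' S,
    sol_concat_add A B x hU hω hω' hS hT⟩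

theorem mem_positiveOrbit_iff (hU : Bornology.IsBounded U) {x y : Fin d → ℝ} :
    y ∈ positiveOrbit A B U x ↔ ∃ T, Steers A B U T x y := by
  constructor
  · rintro ⟨s, hs, ω, hω, ξ, hξ, rfl⟩
    rw [hξ.eq_sol (intervalIntegrable_of_mem_controls hU hω)]
    exact ⟨s, hs, ω, hω, rfl⟩
  · rintro ⟨s, hs, ω, hω, rfl⟩
    exact ⟨s, hs, ω, hω, _, isTrajectory_sol A B x (intervalIntegrable_of_mem_controls hU hω), rfl⟩

theorem eventually_steers_forward (hAB : IsControllable A B) (hU0 : U ∈ 𝓝 0) {h : ℝ} (hh : 0 < h)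
    (x : Fin d → ℝ) : ∀ᶠ y in 𝓝 (flow A h *ᵥ x), Steers A B U h x y := by
  obtain ⟨r, hr, hrU⟩ := Metric.nhds_basis_closedBall.mem_iff.1 hU0
  obtain ⟨δ, hδ, H⟩ := exists_small_control hAB hh hr
  filter_upwards [Metric.closedBall_mem_nhds _ hδ] with y hy
  obtain ⟨v, hv, hvr, hvy⟩ := H (y - flow A h *ᵥ x) (by rwa [← dist_eq_norm])
  refine ⟨hh.le, v, ⟨hv.aemeasurable, Eventually.of_forall fun s => hrU ?_⟩, ?_⟩
  · rw [mem_closedBall_zero_iff]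
    exact hvr s
  · rw [sol_eq_flow_add, hvy]
    abel

theorem eventually_steers_backward (hAB : IsControllable A B) (hU0 : U ∈ 𝓝 0) {h : ℝ} (hh : 0 < h)
    (y : Fin d → ℝ) : ∀ᶠ x in 𝓝 (flow A (-h) *ᵥ y), Steers A B U h x y := by
  obtain ⟨r, hr, hrU⟩ := Metric.nhds_basis_closedBall.mem_iff.1 hU0
  obtain ⟨δ, hδ, H⟩ := exists_small_control hAB hh hr
  have hc : Tendsto (fun x => y - flow A h *ᵥ x) (𝓝 (flow A (-h) *ᵥ y)) (𝓝 0) := by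
    have hcont : Continuous fun x : Fin d → ℝ => y - flow A h *ᵥ x :=
      continuous_const.sub (continuous_const.matrix_mulVec continuous_id)
    have := hcont.tendsto (flow A (-h) *ᵥ y)
    rwa [Matrix.mulVec_mulVec, flow_mul_flow_neg, Matrix.one_mulVec, sub_self] at this
  filter_upwards [hc (Metric.closedBall_mem_nhds _ hδ)] with x hx
  obtain ⟨v, hv, hvr, hvy⟩ := H (y - flow A h *ᵥ x) (by simpa using hx)
  refine ⟨hh.le, v, ⟨hv.aemeasurable, Eventually.of_forall fun s => hrU ?_⟩, ?_⟩
  · rw [mem_closedBall_zero_iff]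
    exact hvr s
  · rw [sol_eq_flow_add, hvy]
    abel

end

/-! ### Control sets: existence and uniqueness -/

section

variable {d m : ℕ} {A : Matrix (Fin d) (Fin d) ℝ} {B : Matrix (Fin d) (Fin m) ℝ}
  {U : Set (Fin m → ℝ)}

theorem Steers.refl (hU : U.Nonempty) (x : Fin d → ℝ) : Steers A B U 0 x x := by
  obtain ⟨u, hu⟩ := hU
  exact ⟨le_rfl, _, const_mem_controls hu, sol_zero_time A B x _⟩

theorem steers_sol {ω : ℝ → Fin m → ℝ} (hω : ω ∈ controls U) {t : ℝ} (ht : 0 ≤ t)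
    (x : Fin d → ℝ) : Steers A B U t x (sol A B x ω t) :=
  ⟨ht, ω, hω, rfl⟩

theorem steers_sol_sol (hU : Bornology.IsBounded U) {ω : ℝ → Fin m → ℝ} (hω : ω ∈ controls U)
    {t T : ℝ} (htT : t ≤ T) (x : Fin d → ℝ) :
    Steers A B U (T - t) (sol A B x ω t) (sol A B x ω T) := by
  refine ⟨sub_nonneg.2 htT, _, shift_mem_controls hω t, ?_⟩
  rw [← sol_add A B x (intervalIntegrable_of_mem_controls hU hω), add_sub_cancel]

theorem isControlledInvariant_iff (hU : Bornology.IsBounded U) {D : Set (Fin d → ℝ)} :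
    IsControlledInvariant A B U D ↔
      ∀ x ∈ D, ∃ ω ∈ controls U, ∀ t, 0 ≤ t → sol A B x ω t ∈ D := by
  refine forall₂_congr fun x _ => exists_congr fun ω => and_congr_right fun hω => ?_
  simp only [isTrajectory_iff A B x (intervalIntegrable_of_mem_controls hU hω), exists_eq_left]

theorem Steers.mem_closure (hU : Bornology.IsBounded U) {T : ℝ} {x y : Fin d → ℝ}
    (h : Steers A B U T x y) : y ∈ closure (positiveOrbit A B U x) :=
  subset_closure ((mem_positiveOrbit_iff hU).2 ⟨T, h⟩)

theorem mem_closure_positiveOrbit_trans (hU : Bornology.IsBounded U) {x y z : Fin d → ℝ}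
    (hxy : y ∈ closure (positiveOrbit A B U x)) (hyz : z ∈ closure (positiveOrbit A B U y)) :
    z ∈ closure (positiveOrbit A B U x) := by
  refine closure_minimal ?_ isClosed_closure hyz
  intro w hw
  obtain ⟨T, hT, ω, hω, rfl⟩ := (mem_positiveOrbit_iff hU).1 hw
  refine map_mem_closure (f := fun v => sol A B v ω T) (continuous_sol_initial A B ω T) hxy
    fun v hv => ?_
  obtain ⟨S, hS⟩ := (mem_positiveOrbit_iff hU).1 hv
  exact (mem_positiveOrbit_iff hU).2 ⟨_, hS.trans hU (steers_sol hω hT v)⟩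

theorem isApproxControllable_of_center (hU : Bornology.IsBounded U) {E : Set (Fin d → ℝ)}
    (x : Fin d → ℝ) (h : ∀ y ∈ E, y ∈ closure (positiveOrbit A B U x) ∧
      x ∈ closure (positiveOrbit A B U y)) : IsApproxControllable A B U E :=
  fun p hp _ hq => mem_closure_positiveOrbit_trans hU (h p hp).2 (h _ hq).1

/-- The union D ∪ E again has both defining properties, approximate controllability passing through
x and y; maximality of D absorbs E. -/
theorem IsControlSet.subset_of_connected (hU : Bornology.IsBounded U) {D E : Set (Fin d → ℝ)}
    (hD : IsControlSet A B U D) (hE₁ : IsControlledInvariant A B U E)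
    (hE₂ : IsApproxControllable A B U E) {x y : Fin d → ℝ} (hx : x ∈ D) (hy : y ∈ E)
    (hxy : y ∈ closure (positiveOrbit A B U x)) (hyx : x ∈ closure (positiveOrbit A B U y)) :
    E ⊆ D := by
  refine Set.subset_union_right.trans (hD.2 (y := D ∪ E) ⟨?_, ?_⟩ Set.subset_union_left)
  · rintro z (hz | hz)
    · obtain ⟨ω, hω, ξ, hξ, h⟩ := hD.1.1 z hz
      exact ⟨ω, hω, ξ, hξ, fun t ht => Or.inl (h t ht)⟩
    · obtain ⟨ω, hω, ξ, hξ, h⟩ := hE₁ z hz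
      exact ⟨ω, hω, ξ, hξ, fun t ht => Or.inr (h t ht)⟩
  · refine isApproxControllable_of_center hU x ?_
    rintro z (hz | hz)
    · exact ⟨hD.1.2 x hx hz, hD.1.2 z hz hx⟩
    · exact ⟨mem_closure_positiveOrbit_trans hU hxy (hE₂ y hy hz),
        mem_closure_positiveOrbit_trans hU (hE₂ z hz hy) hyx⟩

/-- A trajectory that starts and ends in a control set does not leave it in between. -/
theorem IsControlSet.sol_mem (hU : Bornology.IsBounded U) {D : Set (Fin d → ℝ)}
    (hD : IsControlSet A B U D) {x : Fin d → ℝ} (hx : x ∈ D) {ω : ℝ → Fin m → ℝ}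
    (hω : ω ∈ controls U) {T : ℝ} (hT : sol A B x ω T ∈ D) {t : ℝ} (ht : 0 ≤ t) (htT : t ≤ T) :
    sol A B x ω t ∈ D := by
  -- Adjoining the trajectory arc to D preserves both properties, since the arc starts in D and
  -- returns to it; maximality puts the arc inside D.
  set E : Set (Fin d → ℝ) := D ∪ {y | ∃ t, 0 ≤ t ∧ t ≤ T ∧ sol A B x ω t = y} with hE
  have hmem : ∀ t, 0 ≤ t → t ≤ T → sol A B x ω t ∈ E := fun t h0 h1 => Or.inr ⟨t, h0, h1, rfl⟩
  refine hD.2 (y := E) ⟨?_, ?_⟩ Set.subset_union_left (hmem t ht htT)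
  · rw [isControlledInvariant_iff hU]
    have hDi := (isControlledInvariant_iff hU).1 hD.1.1
    rintro z (hz | ⟨s, hs0, hsT, rfl⟩)
    · obtain ⟨ω', hω', h⟩ := hDi z hz
      exact ⟨ω', hω', fun t ht => Or.inl (h t ht)⟩
    · obtain ⟨ω', hω', h⟩ := hDi _ hT
      have hsh := shift_mem_controls hω s
      have hadd := sol_add A B x (intervalIntegrable_of_mem_controls hU hω) s
      refine ⟨concat (T - s) (fun r => ω (s + r)) ω', concat_mem_controls hsh hω' _,
        fun r hr => ?_⟩
      rcases le_total r (T - s) with hrT | hrT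
      · rw [sol_concat_of_le A B _ hr hrT, ← hadd]
        exact hmem _ (by linarith) (by linarith)
      · rw [← add_sub_cancel (T - s) r, sol_concat_add A B _ hU hsh hω' (by linarith) (by linarith),
          ← hadd, add_sub_cancel]
        exact Or.inl (h _ (by linarith))
  · refine isApproxControllable_of_center hU x ?_
    rintro z (hz | ⟨s, hs0, hsT, rfl⟩)
    · exact ⟨hD.1.2 x hx hz, hD.1.2 z hz hx⟩
    · exact ⟨(steers_sol hω hs0 x).mem_closure hU, mem_closure_positiveOrbit_trans hU
        ((steers_sol_sol hU hω hsT x).mem_closure hU) (hD.1.2 _ hT hx)⟩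

/-- The points that can be steered to the origin and are approximately reachable from it. -/
def coreSet (A : Matrix (Fin d) (Fin d) ℝ) (B : Matrix (Fin d) (Fin m) ℝ)
    (U : Set (Fin m → ℝ)) : Set (Fin d → ℝ) :=
  {x | (∃ T, Steers A B U T x 0) ∧ x ∈ closure (positiveOrbit A B U 0)}

theorem eventually_steers_from_zero (hAB : IsControllable A B) (hU0 : U ∈ 𝓝 0) :
    ∀ᶠ y in 𝓝 (0 : Fin d → ℝ), Steers A B U 1 0 y := by
  simpa using eventually_steers_forward hAB hU0 one_pos 0

theorem eventually_steers_to_zero (hAB : IsControllable A B) (hU0 : U ∈ 𝓝 0) :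
    ∀ᶠ y in 𝓝 (0 : Fin d → ℝ), Steers A B U 1 y 0 := by
  simpa using eventually_steers_backward hAB hU0 one_pos 0

theorem coreSet_mem_nhds (hAB : IsControllable A B) (hU : Bornology.IsBounded U)
    (hU0 : U ∈ 𝓝 0) : coreSet A B U ∈ 𝓝 0 := by
  filter_upwards [eventually_steers_from_zero hAB hU0, eventually_steers_to_zero hAB hU0]
    with y h1 h2
  exact ⟨⟨1, h2⟩, h1.mem_closure hU⟩

theorem isControlSet_coreSet (hAB : IsControllable A B) (hU : Bornology.IsBounded U)
    (hU0 : U ∈ 𝓝 0) : IsControlSet A B U (coreSet A B U) := by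
  have h0 : (0 : Fin d → ℝ) ∈ coreSet A B U := mem_of_mem_nhds (coreSet_mem_nhds hAB hU hU0)
  have hz : (0 : ℝ → Fin m → ℝ) ∈ controls U := const_mem_controls (mem_of_mem_nhds hU0)
  refine ⟨⟨?_, ?_⟩, ?_⟩
  · rw [isControlledInvariant_iff hU]
    rintro x ⟨⟨T, hT, ω, hω, hx⟩, hcl⟩
    refine ⟨concat T ω 0, concat_mem_controls hω hz T, fun t ht => ?_⟩
    rcases le_total t T with htT | htT
    · rw [sol_concat_of_le A B x ht htT]
      refine ⟨⟨T - t, ?_⟩, mem_closure_positiveOrbit_trans hU hcl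
        ((steers_sol hω ht x).mem_closure hU)⟩
      rw [← hx]
      exact steers_sol_sol hU hω htT x
    · rw [← add_sub_cancel T t, sol_concat_add A B x hU hω hz hT (by linarith), hx,
        sol_zero_control, Matrix.mulVec_zero]
      exact h0
  · refine isApproxControllable_of_center hU 0 ?_
    rintro y ⟨⟨T, hT⟩, hcl⟩
    exact ⟨hcl, hT.mem_closure hU⟩
  · rintro E ⟨-, hE⟩ hsub y hy
    have h0E := hsub h0
    refine ⟨?_, hE 0 h0E hy⟩
    -- Approximate reachability of 0 becomes exact: a reachable point close enough to 0 is steered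
    -- to 0 in time 1.
    obtain ⟨z, hz, hzy⟩ := mem_closure_iff_nhds.1 (hE y hy h0E) _
      (eventually_steers_to_zero hAB hU0)
    obtain ⟨T, hT⟩ := (mem_positiveOrbit_iff hU).1 hzy
    exact ⟨_, hT.trans hU hz⟩

/-- `x` and `y` can be steered to each other. -/
def Mutual (A : Matrix (Fin d) (Fin d) ℝ) (B : Matrix (Fin d) (Fin m) ℝ) (U : Set (Fin m → ℝ))
    (x y : Fin d → ℝ) : Prop :=
  (∃ T, Steers A B U T x y) ∧ ∃ T, Steers A B U T y x

theorem Mutual.symm {x y : Fin d → ℝ} (h : Mutual A B U x y) : Mutual A B U y x := ⟨h.2, h.1⟩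

theorem Mutual.trans (hU : Bornology.IsBounded U) {x y z : Fin d → ℝ} (h : Mutual A B U x y)
    (h' : Mutual A B U y z) : Mutual A B U x z := by
  obtain ⟨⟨T₁, h₁⟩, T₂, h₂⟩ := h
  obtain ⟨⟨T₃, h₃⟩, T₄, h₄⟩ := h'
  exact ⟨⟨_, h₁.trans hU h₃⟩, _, h₄.trans hU h₂⟩

section Loop

variable (hAB : IsControllable A B) (hU : Bornology.IsBounded U) (hU0 : U ∈ 𝓝 0)
include hAB hU hU0

/-- The control-free segment of length h leaves room for small controls, which perturb the endpoint
in all directions whatever the position of ω in U. -/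
theorem eventually_steers_of_loop {ω : ℝ → Fin m → ℝ} (hω : ω ∈ controls U) {T h : ℝ}
    (hT : 0 ≤ T) (hh : 0 < h) {p : Fin d → ℝ} (hp : flow A h *ᵥ sol A B p ω T = p) :
    (∀ᶠ y in 𝓝 p, Steers A B U (T + h) p y) ∧ ∀ᶠ x in 𝓝 p, Steers A B U (T + h) x p := by
  constructor
  · have h1 := eventually_steers_forward hAB hU0 hh (sol A B p ω T)
    rw [hp] at h1
    filter_upwards [h1] with y hy
    exact (steers_sol hω hT p).trans hU hy
  · have h1 := eventually_steers_backward hAB hU0 hh p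
    have h2 : flow A (-h) *ᵥ p = sol A B p ω T := by
      conv_lhs => rw [← hp]
      rw [Matrix.mulVec_mulVec, flow_neg_mul_flow, Matrix.one_mulVec]
    rw [h2] at h1
    filter_upwards [(continuous_sol_initial A B ω T).continuousAt.eventually h1] with x hx
    exact (steers_sol hω hT x).trans hU hx

/-- Truncate the control at S ∈ [0, T] and let `q S` be the unique point closed up by it followed by
free flow for time h. This curve is continuous and runs from 0 to p. Each of its points is mutually
reachable with its neighbors on the curve, so connectedness of [0, T] links 0 to p. -/
theorem mutual_zero_of_loop {P : Matrix (Fin d) (Fin d) ℝ} {C α : ℝ} (hP : IsDichotomy A P C α)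
    {ω : ℝ → Fin m → ℝ} (hω : ω ∈ controls U) {T h : ℝ}
    (hT : 0 ≤ T) (hh : 0 < h) {p : Fin d → ℝ} (hp : flow A h *ᵥ sol A B p ω T = p) :
    Mutual A B U 0 p := by
  set q : ℝ → Fin d → ℝ := fun S => (1 - flow A (h + S))⁻¹ *ᵥ (flow A h *ᵥ sol A B 0 ω S) with hq
  have hunit : ∀ S ∈ Set.Icc 0 T, IsUnit (1 - flow A (h + S)).det := fun S hS =>
    (Matrix.isUnit_iff_isUnit_det _).1 (hP.isUnit_one_sub_flow (by linarith [hS.1]))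
  have hloop : ∀ S ∈ Set.Icc 0 T, flow A h *ᵥ sol A B (q S) ω S = q S := by
    intro S hS
    have h1 : (1 - flow A (h + S)) *ᵥ q S = flow A h *ᵥ sol A B 0 ω S := by
      rw [hq, Matrix.mulVec_mulVec, Matrix.mul_nonsing_inv _ (hunit S hS), Matrix.one_mulVec]
    rw [sol_eq_flow_add, Matrix.mulVec_add, ← h1, Matrix.mulVec_mulVec, ← flow_add,
      Matrix.sub_mulVec, Matrix.one_mulVec]
    abel
  have hqp : q T = p := by
    have h1 : (1 - flow A (h + T)) *ᵥ p = flow A h *ᵥ sol A B 0 ω T := by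
      rw [Matrix.sub_mulVec, Matrix.one_mulVec, sub_eq_iff_eq_add, flow_add,
        ← Matrix.mulVec_mulVec, ← Matrix.mulVec_add, add_comm, ← sol_eq_flow_add, hp]
    rw [hq]
    simp only
    rw [← h1, Matrix.mulVec_mulVec, Matrix.nonsing_inv_mul _ (hunit T ⟨hT, le_rfl⟩),
      Matrix.one_mulVec]
  have hq0 : q 0 = 0 := by
    simp [hq, sol_zero_time]
  have hcont : ContinuousOn q (Set.Icc 0 T) := by
    have hM : Continuous fun S => 1 - flow A (h + S) :=
      continuous_const.sub ((continuous_flow A).comp (continuous_const.add continuous_id))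
    have hinv : ContinuousOn (fun S => (1 - flow A (h + S))⁻¹) (Set.Icc 0 T) := by
      simp only [Matrix.inv_def, Ring.inverse_eq_inv']
      refine ContinuousOn.smul (ContinuousOn.inv₀ hM.matrix_det.continuousOn
        fun S hS => (hunit S hS).ne_zero) hM.matrix_adjugate.continuousOn
    have hs : Continuous fun S => flow A h *ᵥ sol A B 0 ω S :=
      continuous_const.matrix_mulVec
        (continuous_sol A B 0 (intervalIntegrable_of_mem_controls hU hω))
    rw [continuousOn_iff_continuous_domRestrict] at hinv ⊢
    exact hinv.matrix_mulVec (hs.comp continuous_subtype_val)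
  have key := isPreconnected_Icc.induction₂ (s := Set.Icc 0 T)
    (fun S S' => Mutual A B U (q S) (q S')) (fun S hS => by
      obtain ⟨h1, h2⟩ := eventually_steers_of_loop hAB hU hU0 hω hS.1 hh (hloop S hS)
      filter_upwards [(hcont S hS).eventually h1, (hcont S hS).eventually h2] with S' h3 h4
      exact ⟨⟨_, h3⟩, _, h4⟩)
    (fun _ _ _ _ _ _ h1 h2 => h1.trans hU h2) (fun _ _ _ _ h1 => h1.symm)
    (x := 0) (y := T) ⟨le_rfl, hT⟩ ⟨hT, le_rfl⟩
  rwa [hq0, hqp] at key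

/-- A loop with a free segment is built near x. From x one reaches some w close to e^{-2hA}x; free
flow for time h takes w close to e^{-hA}x, from where x is reached exactly in time h. The loop is
based at e^{hA}w. -/
theorem IsControlSet.mutual_zero {P : Matrix (Fin d) (Fin d) ℝ} {C α : ℝ}
    (hP : IsDichotomy A P C α) {D : Set (Fin d → ℝ)} (hD : IsControlSet A B U D)
    {x : Fin d → ℝ} (hx : x ∈ interior D) : Mutual A B U 0 x := by
  have hxD := interior_subset hx
  have hlim : Tendsto (fun h : ℝ => flow A (-(2 * h)) *ᵥ x) (𝓝[>] 0) (𝓝 x) := by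
    have hc : Continuous fun h : ℝ => flow A (-(2 * h)) *ᵥ x :=
      ((continuous_flow_neg A).comp (continuous_const.mul continuous_id)).matrix_mulVec
        continuous_const
    have := hc.tendsto 0
    simp only [mul_zero, neg_zero, flow_zero, Matrix.one_mulVec] at this
    exact this.mono_left nhdsWithin_le_nhds
  obtain ⟨h, hh, hhD⟩ := ((eventually_mem_nhdsWithin).and
    (hlim.eventually (isOpen_interior.mem_nhds hx))).exists
  replace hh : 0 < h := hh
  have h1 := eventually_steers_backward hAB hU0 hh x
  have h2 : ∀ᶠ w in 𝓝 (flow A (-(2 * h)) *ᵥ x), Steers A B U h (flow A h *ᵥ w) x := by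
    have hc : Continuous fun w : Fin d → ℝ => flow A h *ᵥ w :=
      continuous_const.matrix_mulVec continuous_id
    refine (hc.tendsto (flow A (-(2 * h)) *ᵥ x)).eventually (p := fun v => Steers A B U h v x) ?_
    rw [Matrix.mulVec_mulVec, ← flow_add, show h + -(2 * h) = -h by ring]
    exact h1
  obtain ⟨w, hw, hwx⟩ := mem_closure_iff_nhds.1 (hD.1.2 x hxD (interior_subset hhD)) _ h2
  obtain ⟨T₁, hT₁⟩ := (mem_positiveOrbit_iff hU).1 hwx
  obtain ⟨hT, ω, hω, hω'⟩ := Steers.trans hU hw hT₁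
  have hloop := mutual_zero_of_loop hAB hU hU0 hP hω hT hh (p := flow A h *ᵥ w) (by rw [hω'])
  have hz : (0 : ℝ → Fin m → ℝ) ∈ controls U := const_mem_controls (mem_of_mem_nhds hU0)
  have hwp : Steers A B U h w (flow A h *ᵥ w) := ⟨hh.le, 0, hz, sol_zero_control A B w h⟩
  exact hloop.trans hU ⟨⟨_, hw⟩, _, hT₁.trans hU hwp⟩

theorem IsControlSet.eq_coreSet {P : Matrix (Fin d) (Fin d) ℝ} {C α : ℝ}
    (hP : IsDichotomy A P C α) {D : Set (Fin d → ℝ)} (hD : IsControlSet A B U D)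
    (hDi : (interior D).Nonempty) : D = coreSet A B U := by
  obtain ⟨x, hx⟩ := hDi
  obtain ⟨⟨T₁, h₁⟩, T₂, h₂⟩ := hD.mutual_zero hAB hU hU0 hP hx
  have hC := isControlSet_coreSet hAB hU hU0
  have h0 := mem_of_mem_nhds (coreSet_mem_nhds hAB hU hU0)
  have hxD := interior_subset hx
  exact (hC.subset_of_connected hU hD.1.1 hD.1.2 h0 hxD (h₁.mem_closure hU)
    (h₂.mem_closure hU)).antisymm (hD.subset_of_connected hU hC.1.1 hC.1.2 hxD h0
      (h₂.mem_closure hU) (h₁.mem_closure hU))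

theorem existsUnique_isControlSet {P : Matrix (Fin d) (Fin d) ℝ} {C α : ℝ}
    (hP : IsDichotomy A P C α) :
    ∃! D : Set (Fin d → ℝ), IsControlSet A B U D ∧ (interior D).Nonempty :=
  ⟨coreSet A B U, ⟨isControlSet_coreSet hAB hU hU0,
    ⟨0, mem_interior_iff_mem_nhds.2 (coreSet_mem_nhds hAB hU hU0)⟩⟩,
    fun _ h => h.1.eq_coreSet hAB hU hU0 hP h.2⟩

end Loop

/-- Solving for the initial value gives Px = -∫Pe^{-sA}Bω(s)ds, and the integrand decays
exponentially, so the bound does not depend on T. -/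
theorem IsDichotomy.norm_unstable_le {P : Matrix (Fin d) (Fin d) ℝ} {C α : ℝ}
    (hP : IsDichotomy A P C α) {R : ℝ} (hR : ∀ u ∈ U, ‖u‖ ≤ R) (hR0 : 0 ≤ R) {x : Fin d → ℝ} {T : ℝ}
    (hx : Steers A B U T x 0) : ‖P *ᵥ x‖ ≤ C * ‖B‖ * R / α := by
  obtain ⟨hT, ω, hω, hx⟩ := hx
  have hi := intervalIntegrable_of_mem_controls (isBounded_iff_forall_norm_le.2 ⟨R, hR⟩) hω
  have h1 := congrArg (fun v => flow A (-T) *ᵥ v) hx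
  simp only [sol, Matrix.mulVec_mulVec _ (flow A (-T)), flow_neg_mul_flow, Matrix.one_mulVec,
    Matrix.mulVec_zero] at h1
  rw [eq_neg_of_add_eq_zero_left h1, Matrix.mulVec_neg, norm_neg,
    ← integral_const_mulVec _ (intervalIntegrable_flow_neg_mulVec A B hi 0 T)]
  have hα := hP.rate_pos
  have hC := hP.const_pos
  have hder : ∀ s : ℝ, HasDerivAt (fun s => -(C * ‖B‖ * R / α) * Real.exp (-α * s))
      (C * ‖B‖ * R * Real.exp (-α * s)) s := by
    intro s
    have h2 : HasDerivAt (fun s => Real.exp (-α * s)) (Real.exp (-α * s) * (-α * 1)) s :=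
      ((hasDerivAt_id s).const_mul (-α)).exp
    convert! h2.const_mul (-(C * ‖B‖ * R / α)) using 1
    field_simp
  have hcont : Continuous fun s : ℝ => C * ‖B‖ * R * Real.exp (-α * s) := by fun_prop
  calc ‖∫ s in (0 : ℝ)..T, P *ᵥ (flow A (-s) *ᵥ (B *ᵥ ω s))‖
      ≤ ∫ s in (0 : ℝ)..T, C * ‖B‖ * R * Real.exp (-α * s) := by
        refine intervalIntegral.norm_integral_le_of_norm_le hT ?_ (hcont.intervalIntegrable 0 T)
        filter_upwards [hω.2] with s hs hs0
        rw [Matrix.mulVec_mulVec, ← (commute_flow hP.comm (-s)).eq]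
        calc ‖(flow A (-s) * P) *ᵥ (B *ᵥ ω s)‖ ≤ (C * Real.exp (-α * s)) * (‖B‖ * R) := by
              refine (Matrix.linfty_opNorm_mulVec _ _).trans ?_
              gcongr
              · exact hP.unstable_le s hs0.1.le
              · refine (Matrix.linfty_opNorm_mulVec _ _).trans ?_
                gcongr
                exact hR _ hs
          _ = _ := by ring
    _ = C * ‖B‖ * R / α - C * ‖B‖ * R / α * Real.exp (-α * T) := by
        rw [intervalIntegral.integral_eq_sub_of_hasDerivAt (fun s _ => hder s)
          (hcont.intervalIntegrable 0 T), mul_zero, Real.exp_zero]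
        ring
    _ ≤ C * ‖B‖ * R / α := sub_le_self _ (by positivity)

end

/-! ### Volume expansion and the lower bound -/

section

variable {d m : ℕ} {A : Matrix (Fin d) (Fin d) ℝ} {B : Matrix (Fin d) (Fin m) ℝ}
  {U : Set (Fin m → ℝ)}

/-- The flow on the unstable subspace, extended by the identity on the stable subspace. -/
def unstableFlow (A P : Matrix (Fin d) (Fin d) ℝ) (t : ℝ) : Matrix (Fin d) (Fin d) ℝ :=
  (1 - P) + flow A t * P

/-- The unstable flow solves X' = (AP)X with X(0) = 1, so it equals e^{tAP}, and Liouville's formula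
applies with tr(AP) known from the dichotomy. -/
theorem IsDichotomy.det_unstableFlow {P : Matrix (Fin d) (Fin d) ℝ} {C α : ℝ}
    (hP : IsDichotomy A P C α) (t : ℝ) :
    (unstableFlow A P t).det =
      Real.exp (t * ((eigenvalues A).map fun μ : ℂ => max 0 μ.re).sum) := by
  set N := A * P with hN
  have hderiv : ∀ s, HasDerivAt (unstableFlow A P) (N * unstableFlow A P s) s := by
    intro s
    have h1 : N * unstableFlow A P s = A * flow A s * P := by
      have h2 : P * (flow A s * P) = flow A s * P := by
        rw [← mul_assoc, ← (commute_flow hP.comm s).eq, mul_assoc, hP.idem]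
      rw [unstableFlow, hN, mul_add, mul_assoc A P (1 - P), mul_sub, mul_one, hP.idem, sub_self,
        mul_zero, zero_add, mul_assoc A P, h2, mul_assoc]
    rw [h1]
    exact ((hasDerivAt_flow A s).mul_const P).const_add (1 - P)
  have hconst : ∀ s, HasDerivAt (fun s => flow N (-s) * unstableFlow A P s) 0 s := by
    intro s
    convert! (hasDerivAt_flow_neg N s).mul (hderiv s) using 1
    rw [neg_mul, mul_assoc, neg_add_cancel]
  have h := is_const_of_deriv_eq_zero (fun s => (hconst s).differentiableAt)
    (fun s => (hconst s).deriv) t 0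
  have h0 : unstableFlow A P 0 = 1 := by simp [unstableFlow, flow_zero]
  simp only [h0, neg_zero, flow_zero, mul_one] at h
  have h2 : unstableFlow A P t = flow N t := by
    rw [← mul_one (flow N t), ← h, ← mul_assoc, flow_mul_flow_neg, one_mul]
  rw [h2, flow, det_exp_smul, hN, hP.trace_eq]

theorem volume_preimage_mulVec (M : Matrix (Fin d) (Fin d) ℝ) (hM : M.det ≠ 0)
    (s : Set (Fin d → ℝ)) :
    volume ((fun v => M *ᵥ v) ⁻¹' s) = ENNReal.ofReal |M.det⁻¹| * volume s := by
  have h := Measure.addHaar_preimage_linearMap (volume : Measure (Fin d → ℝ))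
    (f := Matrix.toLin' M) (by rwa [LinearMap.det_toLin']) s
  rw [LinearMap.det_toLin'] at h
  exact h

theorem intervalIntegrable_comp_control (hUc : IsCompact U) {f : (Fin m → ℝ) → ℝ}
    (hf : ContinuousOn f U) {ω : ℝ → Fin m → ℝ} (hω : ω ∈ controls U) (a b : ℝ) :
    IntervalIntegrable (fun t => f (ω t)) volume a b := by
  obtain ⟨M, hM⟩ := hUc.exists_bound_of_continuousOn hf
  have hmeas : Measurable (U.indicator f) := by
    classical
    have := hf.measurable_piecewise (g := fun _ => (0 : ℝ)) continuousOn_const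
      hUc.isClosed.measurableSet
    exact this
  rw [intervalIntegrable_iff]
  refine Measure.integrableOn_of_bounded (M := M) (by simp) ?_
    (ae_restrict_of_ae (hω.2.mono fun t ht => hM _ ht))
  have h1 : AEMeasurable (fun t => f (ω t)) volume := by
    refine (hmeas.comp_aemeasurable hω.1).congr ?_
    filter_upwards [hω.2] with t ht
    exact Set.indicator_of_mem ht f
  exact h1.aestronglyMeasurable

theorem le_integral_comp_control (hUc : IsCompact U) {f : (Fin m → ℝ) → ℝ}
    (hf : ContinuousOn f U) {ω : ℝ → Fin m → ℝ} (hω : ω ∈ controls U) {c : ℝ}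
    (hc : ∀ u ∈ U, c ≤ f u) {a b : ℝ} (hab : a ≤ b) :
    (b - a) * c ≤ ∫ t in a..b, f (ω t) := by
  have h := intervalIntegral.integral_mono_ae hab (intervalIntegrable_const (c := c))
    (intervalIntegrable_comp_control hUc hf hω a b) (hω.2.mono fun t ht => hc _ ht)
  simpa using h

theorem integral_comp_control_le (hUc : IsCompact U) {f : (Fin m → ℝ) → ℝ}
    (hf : ContinuousOn f U) {ω : ℝ → Fin m → ℝ} (hω : ω ∈ controls U) {c : ℝ}
    (hc : ∀ u ∈ U, f u ≤ c) {a b : ℝ} (hab : a ≤ b) :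
    ∫ t in a..b, f (ω t) ≤ (b - a) * c := by
  have h := intervalIntegral.integral_mono_ae hab
    (intervalIntegrable_comp_control hUc hf hω a b) (intervalIntegrable_const (c := c))
    (hω.2.mono fun t ht => hc _ ht)
  simpa using h

theorem isSpanning_iff (hU : Bornology.IsBounded U) {τ : ℝ} {K Q : Set (Fin d → ℝ)}
    {S : Set (ℝ → Fin m → ℝ)} :
    IsSpanning A B U τ K Q S ↔
      S ⊆ controls U ∧ ∀ x ∈ K, ∃ ω ∈ S, ∀ t ∈ Set.Icc (0 : ℝ) τ, sol A B x ω t ∈ Q := by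
  refine and_congr_right fun hS => forall₂_congr fun x _ => exists_congr fun ω =>
    and_congr_right fun hω => ?_
  simp only [isTrajectory_iff A B x (intervalIntegrable_of_mem_controls hU (hS hω)),
    exists_eq_left]

/-- Volume counting: K is covered by the sets of points that each single control sends into Q at
time τ. Only the final time and the unstable component in Q are used. -/
theorem IsDichotomy.exists_le_spanningInf {P : Matrix (Fin d) (Fin d) ℝ} {C α : ℝ}
    (hP : IsDichotomy A P C α) (hUc : IsCompact U) {K Q : Set (Fin d → ℝ)} (hK : IsCompact K)
    (hKi : (interior K).Nonempty) {R : ℝ} (hQ : ∀ x ∈ Q, ‖P *ᵥ x‖ ≤ R)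
    {f : (Fin m → ℝ) → ℝ} (hf : ContinuousOn f U) {c : ℝ} (hc : ∀ u ∈ U, c ≤ f u) :
    ∃ k : ℝ, 0 < k ∧ ∀ τ : ℝ, 0 ≤ τ → ENNReal.ofReal (k * Real.exp (τ *
      (c + ((eigenvalues A).map fun μ : ℂ => max 0 μ.re).sum))) ≤
        spanningInf A B U f K Q τ := by
  set σ := ((eigenvalues A).map fun μ : ℂ => max 0 μ.re).sum with hσ
  obtain ⟨RK, hRK⟩ := hK.isBounded.exists_norm_le
  set ρ := ‖1 - P‖ * RK + R with hρ
  -- The summand 1 makes positivity of V immediate.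
  set V : ℝ := (volume (Metric.closedBall (0 : Fin d → ℝ) ρ)).toReal + 1 with hV
  have hV0 : 0 < V := by positivity
  have hball : ∀ p : Fin d → ℝ, volume (Metric.closedBall p ρ) ≤ ENNReal.ofReal V := by
    intro p
    rw [Measure.addHaar_closedBall_center]
    rw [← ENNReal.ofReal_toReal (measure_closedBall_lt_top (μ := volume)
      (x := (0 : Fin d → ℝ)) (r := ρ)).ne]
    exact ENNReal.ofReal_le_ofReal (by rw [hV]; linarith)
  have hKpos : 0 < (volume K).toReal := by
    refine ENNReal.toReal_pos ?_ hK.measure_lt_top.ne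
    exact ((isOpen_interior.measure_pos volume hKi).trans_le (measure_mono interior_subset)).ne'
  have hvol : ∀ (ω : ℝ → Fin m → ℝ) (τ : ℝ),
      volume {x ∈ K | sol A B x ω τ ∈ Q} ≤ ENNReal.ofReal (Real.exp (-(τ * σ)) * V) := by
    intro ω τ
    have hdet := hP.det_unstableFlow τ
    have hsub : {x ∈ K | sol A B x ω τ ∈ Q} ⊆ (fun v => unstableFlow A P τ *ᵥ v) ⁻¹'
        Metric.closedBall (-(P *ᵥ sol A B 0 ω τ)) ρ := by
      rintro x ⟨hxK, hxQ⟩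
      rw [Set.mem_preimage, mem_closedBall_iff_norm, sub_neg_eq_add]
      -- Up to a translation depending only on ω, the unstable flow sends x to its initial stable
      -- component plus its final unstable component, both bounded.
      have h1 : unstableFlow A P τ *ᵥ x + P *ᵥ sol A B 0 ω τ =
          (1 - P) *ᵥ x + P *ᵥ sol A B x ω τ := by
        rw [sol_eq_flow_add A B x, unstableFlow, (commute_flow hP.comm τ).eq, Matrix.add_mulVec,
          Matrix.mulVec_add, Matrix.mulVec_mulVec, add_assoc]
      rw [h1]
      refine (norm_add_le _ _).trans (add_le_add ((Matrix.linfty_opNorm_mulVec _ _).trans ?_)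
        (hQ _ hxQ))
      gcongr
      exact hRK x hxK
    refine (measure_mono hsub).trans ?_
    rw [volume_preimage_mulVec _ (by rw [hdet]; positivity), hdet, abs_of_pos (by positivity),
      ← Real.exp_neg, ENNReal.ofReal_mul (Real.exp_pos _).le]
    gcongr
    exact hball _
  refine ⟨(volume K).toReal / V, by positivity, fun τ hτ => ?_⟩
  refine le_iInf₂ fun S hS => ?_
  obtain ⟨hSU, hS⟩ := (isSpanning_iff hUc.isBounded).1 hS
  have hterm : ∀ ω : S, ENNReal.ofReal (Real.exp (τ * c)) ≤ ENNReal.ofReal (Real.exp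
      (∫ t in (0 : ℝ)..τ, f ((ω : ℝ → Fin m → ℝ) t))) := by
    intro ω
    have := le_integral_comp_control hUc hf (hSU ω.2) hc hτ
    rw [sub_zero] at this
    exact ENNReal.ofReal_le_ofReal (Real.exp_le_exp.2 this)
  rcases finite_or_infinite S with hfin | hinf
  · have hcover : K ⊆ ⋃ ω : S, {x ∈ K | sol A B x ω τ ∈ Q} := by
      intro x hx
      obtain ⟨ω, hω, h⟩ := hS x hx
      exact Set.mem_iUnion.2 ⟨⟨ω, hω⟩, hx, h τ ⟨hτ, le_rfl⟩⟩
    have hle : volume K ≤ ENNReal.ofReal (Real.exp (-(τ * (c + σ))) * V) *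
        ∑' ω : S, ENNReal.ofReal (Real.exp (∫ t in (0 : ℝ)..τ, f ((ω : ℝ → Fin m → ℝ) t))) := by
      refine (measure_mono hcover).trans ((measure_iUnion_le _).trans ?_)
      rw [← ENNReal.tsum_mul_left]
      refine ENNReal.tsum_le_tsum fun ω => (hvol ω τ).trans ?_
      refine le_trans ?_ (mul_le_mul_right (hterm ω) _)
      rw [← ENNReal.ofReal_mul (by positivity)]
      refine ENNReal.ofReal_le_ofReal (le_of_eq ?_)
      rw [mul_right_comm, ← Real.exp_add]
      congr 2
      ring
    calc ENNReal.ofReal ((volume K).toReal / V * Real.exp (τ * (c + σ)))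
        = ENNReal.ofReal (Real.exp (τ * (c + σ)) / V) * volume K := by
          conv_rhs => rw [← ENNReal.ofReal_toReal hK.measure_lt_top.ne]
          rw [← ENNReal.ofReal_mul (by positivity)]
          congr 1
          ring
      _ ≤ ENNReal.ofReal (Real.exp (τ * (c + σ)) / V) *
          (ENNReal.ofReal (Real.exp (-(τ * (c + σ))) * V) * ∑' ω : S, _) :=
          mul_le_mul_right hle _
      _ = _ := by
          rw [← mul_assoc, ← ENNReal.ofReal_mul (by positivity)]
          rw [show Real.exp (τ * (c + σ)) / V * (Real.exp (-(τ * (c + σ))) * V) = 1 by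
            rw [Real.exp_neg]; field_simp]
          rw [ENNReal.ofReal_one, one_mul]
  -- An infinite spanning set has infinite sum, because its terms are bounded below by a positive
  -- constant.
  · refine le_top.trans ?_
    rw [← ENNReal.tsum_const_eq_top_of_ne_zero (α := S)
      (c := ENNReal.ofReal (Real.exp (τ * c))) (by simp [Real.exp_pos])]
    exact ENNReal.tsum_le_tsum hterm

end

/-! ### Bowen balls and covers of optimal cardinality -/

section

variable {d m : ℕ} {A : Matrix (Fin d) (Fin d) ℝ} {B : Matrix (Fin d) (Fin m) ℝ}
  {U : Set (Fin m → ℝ)}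

/-- The vectors of norm at most `r` whose image under the flow at time `T` has norm at most `r`. -/
def bowenBall (A : Matrix (Fin d) (Fin d) ℝ) (T r : ℝ) : Set (Fin d → ℝ) :=
  {v | ‖v‖ ≤ r ∧ ‖flow A T *ᵥ v‖ ≤ r}

theorem isClosed_bowenBall (A : Matrix (Fin d) (Fin d) ℝ) (T r : ℝ) :
    IsClosed (bowenBall A T r) :=
  (isClosed_le continuous_norm continuous_const).inter (isClosed_le
    (continuous_const.matrix_mulVec continuous_id).norm continuous_const)

/-- With w the image of v under the unstable flow, v = (1 - P)w + e^{-TA}Pw and e^{TA}v = e^{TA}(1 -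
P)w + Pw. Both are bounded by a‖w‖ uniformly in T, so the preimage of a fixed ball lies in the Bowen
ball. -/
theorem IsDichotomy.exists_le_volume_bowenBall {P : Matrix (Fin d) (Fin d) ℝ} {C α : ℝ}
    (hP : IsDichotomy A P C α) {r : ℝ} (hr : 0 < r) :
    ∃ k : ℝ, 0 < k ∧ ∀ T : ℝ, 0 ≤ T → ENNReal.ofReal (k * Real.exp (-(T *
      ((eigenvalues A).map fun μ : ℂ => max 0 μ.re).sum))) ≤ volume (bowenBall A T r) := by
  have hC := hP.const_pos
  set a := C + ‖1 - P‖ + ‖P‖ with ha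
  have ha0 : 0 < a := by positivity
  set η := r / a with hη
  have hη0 : 0 < η := by positivity
  refine ⟨(volume (Metric.closedBall (0 : Fin d → ℝ) η)).toReal, ?_, fun T hT => ?_⟩
  · refine ENNReal.toReal_pos ?_ measure_closedBall_lt_top.ne
    exact (Metric.measure_closedBall_pos volume _ hη0).ne'
  have hdet := hP.det_unstableFlow T
  have hdec : ∀ t : ℝ, 0 ≤ t → C * Real.exp (-α * t) ≤ C := fun t ht =>
    mul_le_of_le_one_right hC.le (Real.exp_le_one_iff.2 (by nlinarith [hP.rate_pos]))
  have hsub : (fun v => unstableFlow A P T *ᵥ v) ⁻¹' Metric.closedBall 0 η ⊆ bowenBall A T r := by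
    intro v hv
    rw [Set.mem_preimage, mem_closedBall_zero_iff] at hv
    set w := unstableFlow A P T *ᵥ v with hw
    have hQQ : (1 - P) * (1 - P) = 1 - P := by
      rw [mul_sub, mul_one, sub_mul, one_mul, hP.idem, sub_self, sub_zero]
    have hQP : (1 - P) * P = 0 := by rw [sub_mul, one_mul, hP.idem, sub_self]
    have hcom := (commute_flow hP.comm T).eq
    have h1 : (1 - P) *ᵥ w = (1 - P) *ᵥ v := by
      rw [hw, unstableFlow, Matrix.mulVec_mulVec, mul_add, hQQ, hcom, ← mul_assoc, hQP, zero_mul,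
        add_zero]
    have h2 : P *ᵥ w = flow A T *ᵥ (P *ᵥ v) := by
      rw [hw, unstableFlow, Matrix.mulVec_mulVec, Matrix.mulVec_mulVec, mul_add, mul_sub, mul_one,
        hP.idem, sub_self, zero_add, hcom, ← mul_assoc, hP.idem]
    have h3 : P *ᵥ v = (flow A (-T) * P) *ᵥ w := by
      rw [← Matrix.mulVec_mulVec, h2, Matrix.mulVec_mulVec, flow_neg_mul_flow, Matrix.one_mulVec]
    have hv' : v = (1 - P) *ᵥ v + P *ᵥ v := by
      rw [Matrix.sub_mulVec, Matrix.one_mulVec, sub_add_cancel]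
    have hle : ∀ M N : Matrix (Fin d) (Fin d) ℝ, ‖M‖ + ‖N‖ ≤ a →
        ‖M *ᵥ w + N *ᵥ w‖ ≤ r := by
      intro M N hMN
      calc ‖M *ᵥ w + N *ᵥ w‖ ≤ ‖M‖ * ‖w‖ + ‖N‖ * ‖w‖ := (norm_add_le _ _).trans
            (add_le_add (Matrix.linfty_opNorm_mulVec _ _) (Matrix.linfty_opNorm_mulVec _ _))
        _ = (‖M‖ + ‖N‖) * ‖w‖ := by ring
        _ ≤ a * η := by gcongr
        _ = r := by rw [hη]; field_simp
    constructor
    · rw [hv', ← h1, h3]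
      refine hle _ _ ?_
      have := (hP.unstable_le T hT).trans (hdec T hT)
      rw [ha]
      linarith [norm_nonneg P]
    · rw [hv', Matrix.mulVec_add, ← h1, ← h2, Matrix.mulVec_mulVec]
      refine hle _ _ ?_
      have := (hP.stable_le T hT).trans (hdec T hT)
      rw [ha]
      linarith [norm_nonneg (1 - P)]
  refine le_trans (le_of_eq ?_) (measure_mono hsub)
  rw [volume_preimage_mulVec _ (by rw [hdet]; positivity), hdet, abs_of_pos (by positivity),
    ← Real.exp_neg, mul_comm, ENNReal.ofReal_mul (Real.exp_pos _).le,
    ENNReal.ofReal_toReal measure_closedBall_lt_top.ne]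

theorem exists_finset_maximal_card {X : Type*} (p : Finset X → Prop) (h0 : p ∅) (N : ℕ)
    (hN : ∀ Z, p Z → Z.card ≤ N) : ∃ Z, p Z ∧ ∀ Z', p Z' → Z'.card ≤ Z.card := by
  classical
  let q : ℕ → Prop := fun n => ∃ Z, p Z ∧ Z.card = n
  obtain ⟨Z, hZ, hcard⟩ : q (Nat.findGreatest q N) :=
    Nat.findGreatest_spec (P := q) (Nat.zero_le N) ⟨∅, h0, rfl⟩
  exact ⟨Z, hZ, fun Z' hZ' => hcard ▸ Nat.le_findGreatest (hN Z' hZ') ⟨Z', hZ', rfl⟩⟩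

/-- A ball is covered by exponentially many sets that the flow at time `T` maps to translates of
the ball. -/
theorem IsDichotomy.exists_finset_cover {P : Matrix (Fin d) (Fin d) ℝ} {C α : ℝ}
    (hP : IsDichotomy A P C α) {δ : ℝ} (hδ : 0 < δ) (p : Fin d → ℝ) :
    ∃ κ : ℝ, 0 < κ ∧ ∀ T : ℝ, 0 ≤ T → ∃ Z : Finset (Fin d → ℝ),
      (Z.card : ℝ) ≤ κ * Real.exp (T * ((eigenvalues A).map fun μ : ℂ => max 0 μ.re).sum) ∧
      (∀ z ∈ Z, z ∈ Metric.closedBall p δ) ∧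
      ∀ y ∈ Metric.closedBall p δ, ∃ z ∈ Z, ‖flow A T *ᵥ (y - z)‖ ≤ δ := by
  classical
  set σ := ((eigenvalues A).map fun μ : ℂ => max 0 μ.re).sum with hσ
  obtain ⟨k, hk, hvol⟩ := hP.exists_le_volume_bowenBall (half_pos hδ)
  set V := (volume (Metric.closedBall p (2 * δ))).toReal with hV
  have hV0 : 0 < V := ENNReal.toReal_pos
    (Metric.measure_closedBall_pos volume _ (by positivity)).ne' measure_closedBall_lt_top.ne
  refine ⟨V / k, by positivity, fun T hT => ?_⟩
  let sep : Finset (Fin d → ℝ) → Prop := fun Z => (∀ z ∈ Z, z ∈ Metric.closedBall p δ) ∧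
    ∀ z ∈ Z, ∀ z' ∈ Z, z ≠ z' → δ < ‖flow A T *ᵥ (z - z')‖
  have hcard : ∀ Z, sep Z → (Z.card : ℝ) ≤ V / k * Real.exp (T * σ) := by
    rintro Z ⟨hZ1, hZ2⟩
    -- Half-radius Bowen balls around the points of a separated set are disjoint and lie in the ball
    -- of radius 2δ, so volume bounds their number.
    let Y : (Fin d → ℝ) → Set (Fin d → ℝ) := fun z => (fun x => x + -z) ⁻¹' bowenBall A T (δ / 2)
    have hmeas : ∀ z, MeasurableSet (Y z) := fun z =>
      ((isClosed_bowenBall A T _).preimage (continuous_id.add continuous_const)).measurableSet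
    have hdisj : (Z : Set (Fin d → ℝ)).PairwiseDisjoint Y := by
      intro z hz z' hz' hne
      refine Set.disjoint_left.2 fun x hx hx' => ?_
      refine (hZ2 z hz z' hz' hne).not_ge ?_
      have h1 : z - z' = (x + -z') - (x + -z) := by abel
      rw [h1, Matrix.mulVec_sub]
      refine (norm_sub_le _ _).trans ?_
      linarith [hx.2, hx'.2]
    have hsub : (⋃ z ∈ Z, Y z) ⊆ Metric.closedBall p (2 * δ) := by
      intro x hx
      simp only [Set.mem_iUnion] at hx
      obtain ⟨z, hz, hx⟩ := hx
      have h1 := hZ1 z hz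
      rw [mem_closedBall_iff_norm] at h1 ⊢
      have h2 : x - p = (x + -z) + (z - p) := by abel
      rw [h2]
      refine (norm_add_le _ _).trans ?_
      linarith [hx.1]
    have h1 := measure_mono (μ := volume) hsub
    rw [measure_biUnion_finset hdisj fun z _ => hmeas z] at h1
    have h2 : ∀ z ∈ Z, volume (Y z) = volume (bowenBall A T (δ / 2)) := fun z _ =>
      measure_preimage_add_right volume (-z) _
    rw [Finset.sum_congr rfl h2, Finset.sum_const, nsmul_eq_mul] at h1
    have h3 := (mul_le_mul_right (hvol T hT) (Z.card : ENNReal)).trans h1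
    rw [← ENNReal.ofReal_natCast, ← ENNReal.ofReal_mul (by positivity),
      ← ENNReal.ofReal_toReal (measure_closedBall_lt_top (μ := volume) (x := p)
        (r := 2 * δ)).ne, ENNReal.ofReal_le_ofReal_iff hV0.le, Real.exp_neg] at h3
    rw [div_mul_eq_mul_div, le_div_iff₀ hk]
    have h4 := mul_le_mul_of_nonneg_right h3 (Real.exp_pos (T * σ)).le
    calc (Z.card : ℝ) * k = Z.card * (k * (Real.exp (T * σ))⁻¹) * Real.exp (T * σ) := by
          field_simp
      _ ≤ _ := h4
  obtain ⟨Z, hZ, hmax⟩ := exists_finset_maximal_card sep ⟨by simp, by simp⟩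
    ⌊V / k * Real.exp (T * σ)⌋₊ fun Z hZ => Nat.le_floor (hcard Z hZ)
  refine ⟨Z, hcard Z hZ, hZ.1, fun y hy => ?_⟩
  -- A separated set of maximal cardinality covers: an uncovered point could be added to it.
  by_contra! hno
  have hyZ : y ∉ Z := fun h => by
    have := hno y h
    rw [sub_self, Matrix.mulVec_zero, norm_zero] at this
    linarith
  have hsep : sep (insert y Z) := by
    refine ⟨fun z hz => ?_, fun z hz z' hz' hne => ?_⟩
    · rcases Finset.mem_insert.1 hz with rfl | hz
      exacts [hy, hZ.1 z hz]
    · rcases Finset.mem_insert.1 hz with h | h <;> rcases Finset.mem_insert.1 hz' with h' | h'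
      · exact absurd (h.trans h'.symm) hne
      · rw [h]
        exact hno z' h'
      · rw [← neg_sub, Matrix.mulVec_neg, norm_neg, h']
        exact hno z h
      · exact hZ.2 z h z' h' hne
  have := hmax _ hsep
  rw [Finset.card_insert_of_notMem hyZ] at this
  omega

end

/-! ### Cheap periodic trajectories and steering families -/

section

variable {d m : ℕ} {A : Matrix (Fin d) (Fin d) ℝ} {B : Matrix (Fin d) (Fin m) ℝ}
  {U : Set (Fin m → ℝ)} {f : (Fin m → ℝ) → ℝ}

theorem integral_comp_concat (hUc : IsCompact U) (hf : ContinuousOn f U) {ω ω' : ℝ → Fin m → ℝ}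
    (hω : ω ∈ controls U) (hω' : ω' ∈ controls U) {S T : ℝ} (hS : 0 ≤ S) (hT : 0 ≤ T) :
    ∫ t in (0 : ℝ)..(S + T), f (concat S ω ω' t) =
      (∫ t in (0 : ℝ)..S, f (ω t)) + ∫ t in (0 : ℝ)..T, f (ω' t) := by
  have hi := intervalIntegrable_comp_control hUc hf (concat_mem_controls hω hω' S)
  rw [← intervalIntegral.integral_add_adjacent_intervals (hi 0 S) (hi S (S + T))]
  congr 1
  · refine intervalIntegral.integral_congr_ae (Eventually.of_forall fun s hs => ?_)
    rw [Set.uIoc_of_le hS] at hs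
    rw [concat, if_pos hs.2]
  · have h := intervalIntegral.integral_comp_add_left (a := 0) (b := T)
      (fun t => f (concat S ω ω' t)) S
    rw [add_zero] at h
    rw [← h]
    refine intervalIntegral.integral_congr_ae (Eventually.of_forall fun s hs => ?_)
    rw [Set.uIoc_of_le hT] at hs
    rw [concat, if_neg (by linarith [hs.1]), add_sub_cancel_left]

/-- There are periodic trajectories through interior points of the core set, with average cost
close to the minimal cost, such that all points of a ball can be steered to the periodic point
in one period. -/
theorem IsDichotomy.exists_periodic {P : Matrix (Fin d) (Fin d) ℝ} {C α : ℝ}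
    (hP : IsDichotomy A P C α) (hAB : IsControllable A B) (hUc : IsCompact U) (hU0 : U ∈ 𝓝 0)
    (hf : ContinuousOn f U) {u₀ : Fin m → ℝ} (hu₀ : u₀ ∈ U) (hmin : IsMinOn f U u₀) {ε : ℝ}
    (hε : 0 < ε) :
    ∃ T₀ : ℝ, 0 < T₀ ∧ ∃ (p : Fin d → ℝ) (δ : ℝ), 0 < δ ∧
      (∀ z ∈ Metric.closedBall p δ, z ∈ coreSet A B U ∧ Steers A B U T₀ z p) ∧
      (∃ T, Steers A B U T 0 p) ∧
      ∃ ω ∈ controls U, sol A B p ω T₀ = p ∧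
        ∫ t in (0 : ℝ)..T₀, f (ω t) ≤ T₀ * (f u₀ + ε) := by
  have hU := hUc.isBounded
  have h0U : (0 : Fin m → ℝ) ∈ U := mem_of_mem_nhds hU0
  have hgap : 0 ≤ f 0 - f u₀ := sub_nonneg.2 (hmin h0U)
  -- The loop uses `u₀` for time T and then the zero control for time 1. The second segment supplies
  -- local controllability even if `u₀` is a boundary point of U; its extra cost f 0 - f u₀ equals T
  -- * ε.
  set T : ℝ := (f 0 - f u₀) / ε with hT
  have hT0 : 0 ≤ T := by positivity
  set ω₁ : ℝ → Fin m → ℝ := fun _ => u₀ with hω₁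
  have hω₁U : ω₁ ∈ controls U := const_mem_controls hu₀
  have hz : (fun _ => 0 : ℝ → Fin m → ℝ) ∈ controls U := const_mem_controls h0U
  have hunit : IsUnit (1 - flow A (1 + T)).det :=
    (Matrix.isUnit_iff_isUnit_det _).1 (hP.isUnit_one_sub_flow (by linarith))
  set p := (1 - flow A (1 + T))⁻¹ *ᵥ (flow A 1 *ᵥ sol A B 0 ω₁ T) with hp
  have hloop : flow A 1 *ᵥ sol A B p ω₁ T = p := by
    have h1 : (1 - flow A (1 + T)) *ᵥ p = flow A 1 *ᵥ sol A B 0 ω₁ T := by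
      rw [hp, Matrix.mulVec_mulVec, Matrix.mul_nonsing_inv _ hunit, Matrix.one_mulVec]
    rw [sol_eq_flow_add, Matrix.mulVec_add, ← h1, Matrix.mulVec_mulVec, ← flow_add,
      Matrix.sub_mulVec, Matrix.one_mulVec]
    abel
  obtain ⟨h1, h2⟩ := eventually_steers_of_loop hAB hU hU0 hω₁U hT0 one_pos hloop
  obtain ⟨⟨S₁, hS₁⟩, S₂, hS₂⟩ := mutual_zero_of_loop hAB hU hU0 hP hω₁U hT0 one_pos hloop
  obtain ⟨δ, hδ, hball⟩ := Metric.nhds_basis_closedBall.mem_iff.1 (h1.and h2)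
  refine ⟨T + 1, by positivity, p, δ, hδ, fun z hz => ?_, ⟨S₁, hS₁⟩, concat T ω₁ fun _ => 0,
    concat_mem_controls hω₁U hz T, ?_, ?_⟩
  · obtain ⟨h3, h4⟩ := hball hz
    exact ⟨⟨⟨_, h4.trans hU hS₂⟩, (hS₁.trans hU h3).mem_closure hU⟩, h4⟩
  · rw [sol_concat_add A B p hU hω₁U hz hT0 zero_le_one]
    exact (sol_zero_control A B _ 1).trans hloop
  · rw [integral_comp_concat hUc hf hω₁U hz hT0 zero_le_one]
    simp only [hω₁, intervalIntegral.integral_const, smul_eq_mul]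
    have : T * ε = f 0 - f u₀ := div_mul_cancel₀ _ hε.ne'
    nlinarith

/-- `x` is steered to `y` in time `T` by an admissible control of cost at most `c`. -/
def CostSteers (A : Matrix (Fin d) (Fin d) ℝ) (B : Matrix (Fin d) (Fin m) ℝ)
    (U : Set (Fin m → ℝ)) (f : (Fin m → ℝ) → ℝ) (T c : ℝ) (x y : Fin d → ℝ) : Prop :=
  0 ≤ T ∧ ∃ ω ∈ controls U, sol A B x ω T = y ∧ ∫ t in (0 : ℝ)..T, f (ω t) ≤ c

theorem CostSteers.trans (hUc : IsCompact U) (hf : ContinuousOn f U) {S T a b : ℝ}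
    {x y z : Fin d → ℝ} (h₁ : CostSteers A B U f S a x y) (h₂ : CostSteers A B U f T b y z) :
    CostSteers A B U f (S + T) (a + b) x z := by
  obtain ⟨hS, ω, hω, rfl, ha⟩ := h₁
  obtain ⟨hT, ω', hω', rfl, hb⟩ := h₂
  refine ⟨add_nonneg hS hT, concat S ω ω', concat_mem_controls hω hω' S,
    sol_concat_add A B x hUc.isBounded hω hω' hS hT, ?_⟩
  rw [integral_comp_concat hUc hf hω hω' hS hT]
  exact add_le_add ha hb

theorem CostSteers.iterate (hUc : IsCompact U) (hf : ContinuousOn f U) {S T a b : ℝ}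
    {x y : Fin d → ℝ} (h₁ : CostSteers A B U f S a x y) (h₂ : CostSteers A B U f T b y y) (k : ℕ) :
    CostSteers A B U f (S + k * T) (a + k * b) x y := by
  induction k with
  | zero => simpa using h₁
  | succ k ih =>
    have := ih.trans hUc hf h₂
    rwa [show S + k * T + T = S + (k + 1 : ℕ) * T by push_cast; ring,
      show a + k * b + b = a + (k + 1 : ℕ) * b by push_cast; ring] at this

theorem Steers.costSteers (hUc : IsCompact U) (hf : ContinuousOn f U) {M : ℝ}
    (hM : ∀ u ∈ U, f u ≤ M) {T : ℝ} {x y : Fin d → ℝ} (h : Steers A B U T x y) :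
    CostSteers A B U f T (T * M) x y := by
  obtain ⟨hT, ω, hω, hxy⟩ := h
  refine ⟨hT, ω, hω, hxy, ?_⟩
  simpa using integral_comp_control_le hUc hf hω hM hT

/-- A finite family of controls, each of cost at most `c`, such that every point of `E` is steered
to `F` in time `T` by one of them. -/
structure IsSteeringFamily (A : Matrix (Fin d) (Fin d) ℝ) (B : Matrix (Fin d) (Fin m) ℝ)
    (U : Set (Fin m → ℝ)) (f : (Fin m → ℝ) → ℝ) (T c : ℝ) (E F : Set (Fin d → ℝ))
    (Ω : Finset (ℝ → Fin m → ℝ)) : Prop where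
  mem_controls : ∀ ω ∈ Ω, ω ∈ controls U
  cost_le : ∀ ω ∈ Ω, ∫ t in (0 : ℝ)..T, f (ω t) ≤ c
  steers : ∀ x ∈ E, ∃ ω ∈ Ω, sol A B x ω T ∈ F

theorem IsSteeringFamily.exists_iterate (hUc : IsCompact U) (hf : ContinuousOn f U) {T c : ℝ}
    (hT : 0 ≤ T) {E : Set (Fin d → ℝ)} {Ω : Finset (ℝ → Fin m → ℝ)}
    (h : IsSteeringFamily A B U f T c E E Ω) (n : ℕ) :
    ∃ Ω' : Finset (ℝ → Fin m → ℝ), Ω'.card ≤ Ω.card ^ n ∧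
      IsSteeringFamily A B U f (n * T) (n * c) E E Ω' := by
  classical
  induction n with
  | zero =>
    -- For n = 0 any single admissible control works; one exists in Ω only when E is nonempty.
    rcases E.eq_empty_or_nonempty with rfl | ⟨x, hx⟩
    · exact ⟨∅, by simp, by simp, by simp, by simp⟩
    · obtain ⟨ω, hω, -⟩ := h.steers x hx
      refine ⟨{ω}, by simp, ?_, ?_, ?_⟩
      · simpa using h.mem_controls ω hω
      · simp
      · intro y hy
        exact ⟨ω, by simp, by simpa [sol_zero_time] using hy⟩
  | succ n ih =>
    obtain ⟨Ω', hcard, h'⟩ := ih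
    have hnT : 0 ≤ n * T := by positivity
    have hcast : ((n + 1 : ℕ) : ℝ) * T = T + n * T := by push_cast; ring
    refine ⟨(Ω ×ˢ Ω').image fun q => concat T q.1 q.2, ?_, ?_, ?_, ?_⟩
    · refine Finset.card_image_le.trans ?_
      rw [Finset.card_product, pow_succ']
      gcongr
    · intro ω hω
      obtain ⟨⟨ω₁, ω₂⟩, hq, rfl⟩ := Finset.mem_image.1 hω
      obtain ⟨h1, h2⟩ := Finset.mem_product.1 hq
      exact concat_mem_controls (h.mem_controls _ h1) (h'.mem_controls _ h2) T
    · intro ω hω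
      obtain ⟨⟨ω₁, ω₂⟩, hq, rfl⟩ := Finset.mem_image.1 hω
      obtain ⟨h1, h2⟩ := Finset.mem_product.1 hq
      rw [hcast, integral_comp_concat hUc hf (h.mem_controls _ h1) (h'.mem_controls _ h2) hT hnT]
      refine (add_le_add (h.cost_le _ h1) (h'.cost_le _ h2)).trans (le_of_eq ?_)
      push_cast
      ring
    · intro x hx
      obtain ⟨ω₁, h1, hx1⟩ := h.steers x hx
      obtain ⟨ω₂, h2, hx2⟩ := h'.steers _ hx1
      refine ⟨concat T ω₁ ω₂, Finset.mem_image.2 ⟨(ω₁, ω₂), Finset.mem_product.2 ⟨h1, h2⟩, rfl⟩, ?_⟩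
      rw [hcast, sol_concat_add A B x hUc.isBounded (h.mem_controls _ h1) (h'.mem_controls _ h2) hT
        hnT]
      exact hx2

/-- Under one control, the difference of two trajectories evolves by the free flow. The control
steering z to p thus sends y to p + e^{TA}(y - z), within δ of p. -/
theorem exists_steeringFamily_of_cover {T c δ : ℝ} {p : Fin d → ℝ} {Z : Finset (Fin d → ℝ)}
    (hZ : ∀ z ∈ Z, CostSteers A B U f T c z p)
    (hcov : ∀ y ∈ Metric.closedBall p δ, ∃ z ∈ Z, ‖flow A T *ᵥ (y - z)‖ ≤ δ) :
    ∃ Ω : Finset (ℝ → Fin m → ℝ), Ω.card ≤ Z.card ∧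
      IsSteeringFamily A B U f T c (Metric.closedBall p δ) (Metric.closedBall p δ) Ω := by
  classical
  choose! g hg using fun z hz => (hZ z hz).2
  refine ⟨Z.image g, Finset.card_image_le, ?_, ?_, fun y hy => ?_⟩
  · intro ω hω
    obtain ⟨z, hz, rfl⟩ := Finset.mem_image.1 hω
    exact (hg z hz).1
  · intro ω hω
    obtain ⟨z, hz, rfl⟩ := Finset.mem_image.1 hω
    exact (hg z hz).2.2
  · obtain ⟨z, hz, hyz⟩ := hcov y hy
    refine ⟨g z, Finset.mem_image_of_mem g hz, ?_⟩
    rw [mem_closedBall_iff_norm]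
    have h1 : sol A B y (g z) T - p = flow A T *ᵥ (y - z) := by
      conv_lhs => rw [← (hg z hz).2.1]
      rw [sol_eq_flow_add A B y, sol_eq_flow_add A B z, Matrix.mulVec_sub]
      abel
    rwa [h1]

/-- Finitely many admissible controls steer a compact set to a neighborhood of a point that can be
reached from every point of the set. -/
theorem exists_finset_steers_of_isCompact {K V : Set (Fin d → ℝ)} (hK : IsCompact K)
    {p : Fin d → ℝ} (hV : V ∈ 𝓝 p) (hKp : ∀ x ∈ K, ∃ T, Steers A B U T x p) :
    ∃ F : Finset (ℝ × (ℝ → Fin m → ℝ)), (∀ q ∈ F, 0 ≤ q.1 ∧ q.2 ∈ controls U) ∧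
      ∀ x ∈ K, ∃ q ∈ F, sol A B x q.2 q.1 ∈ V := by
  classical
  choose! T hT0 ω hω hsol using hKp
  obtain ⟨t, htK, ht⟩ := hK.elim_nhds_subcover (fun x => (fun y => sol A B y (ω x) (T x)) ⁻¹' V)
    fun x hx => (continuous_sol_initial A B (ω x) (T x)).continuousAt (by rwa [hsol x hx])
  refine ⟨t.image fun x => (T x, ω x), ?_, fun x hx => ?_⟩
  · intro q hq
    obtain ⟨x, hx, rfl⟩ := Finset.mem_image.1 hq
    exact ⟨hT0 x (htK x hx), hω x (htK x hx)⟩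
  · obtain ⟨y, hy, hxy⟩ := Set.mem_iUnion₂.1 (ht hx)
    exact ⟨(T y, ω y), Finset.mem_image_of_mem _ hy, hxy⟩

end

/-! ### The upper bound and the pressure formula -/

section

variable {d m : ℕ} {A : Matrix (Fin d) (Fin d) ℝ} {B : Matrix (Fin d) (Fin m) ℝ}
  {U : Set (Fin m → ℝ)} {f : (Fin m → ℝ) → ℝ}

theorem spanningInf_le_of_finset (hU : Bornology.IsBounded U) {τ : ℝ} {K Q : Set (Fin d → ℝ)}
    {S : Finset (ℝ → Fin m → ℝ)} (hS : ∀ ω ∈ S, ω ∈ controls U)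
    (hK : ∀ x ∈ K, ∃ ω ∈ S, ∀ t ∈ Set.Icc (0 : ℝ) τ, sol A B x ω t ∈ Q) {N b : ℝ}
    (hN : (S.card : ℝ) ≤ N) (hb : ∀ ω ∈ S, ∫ t in (0 : ℝ)..τ, f (ω t) ≤ b) :
    spanningInf A B U f K Q τ ≤ ENNReal.ofReal (N * Real.exp b) := by
  refine (iInf₂_le (S : Set (ℝ → Fin m → ℝ)) ((isSpanning_iff hU).2 ⟨hS, hK⟩)).trans ?_
  rw [Finset.tsum_subtype' S fun ω => ENNReal.ofReal (Real.exp (∫ t in (0 : ℝ)..τ, f (ω t)))]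
  refine (Finset.sum_le_card_nsmul S _ (ENNReal.ofReal (Real.exp b)) fun ω hω =>
    ENNReal.ofReal_le_ofReal (Real.exp_le_exp.2 (hb ω hω))).trans ?_
  rw [nsmul_eq_mul, ← ENNReal.ofReal_natCast, ← ENNReal.ofReal_mul (Nat.cast_nonneg _)]
  gcongr

theorem IsDichotomy.exists_spanningInf_le {P : Matrix (Fin d) (Fin d) ℝ} {C α : ℝ}
    (hP : IsDichotomy A P C α) (hAB : IsControllable A B) (hUc : IsCompact U) (hU0 : U ∈ 𝓝 0)
    (hf : ContinuousOn f U) {u₀ : Fin m → ℝ} (hu₀ : u₀ ∈ U) (hmin : IsMinOn f U u₀)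
    {K : Set (Fin d → ℝ)} (hK : IsCompact K) (hKD : K ⊆ coreSet A B U) {ε : ℝ} (hε : 0 < ε) :
    ∃ c : ℝ, ∀ τ : ℝ, 0 ≤ τ → spanningInf A B U f K (coreSet A B U) τ ≤
      ENNReal.ofReal (Real.exp (c + τ * (f u₀ +
        ((eigenvalues A).map fun μ : ℂ => max 0 μ.re).sum + ε))) := by
  classical
  have hU := hUc.isBounded
  set σ := ((eigenvalues A).map fun μ : ℂ => max 0 μ.re).sum with hσ
  obtain ⟨M, hM⟩ := hUc.exists_bound_of_continuousOn hf
  have hM0 : 0 ≤ M := (norm_nonneg _).trans (hM u₀ hu₀)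
  have hMu : ∀ u ∈ U, f u ≤ M := fun u hu => (le_abs_self _).trans (hM u hu)
  have hMl : ∀ u ∈ U, -M ≤ f u := fun u hu => (abs_le.1 (hM u hu)).1
  obtain ⟨T₀, hT₀, p, δ, hδ, hball, ⟨T₁, h0p⟩, ω₀, hω₀, hω₀p, hcost⟩ :=
    hP.exists_periodic hAB hUc hU0 hf hu₀ hmin (half_pos hε)
  obtain ⟨κ, hκ, hcover⟩ := hP.exists_finset_cover hδ p
  -- The number of turns around the loop is large enough for the slack ε/2 per unit time to absorb
  -- log κ and the expensive first period, bounded only by T₀ * M.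
  obtain ⟨k, hk⟩ := exists_nat_ge
    ((Real.log κ + T₀ * (M - f u₀ - ε / 2)) / (T₀ * (ε / 2)))
  rw [div_le_iff₀ (by positivity)] at hk
  set T := T₀ + k * T₀ with hT
  have hTpos : 0 < T := by positivity
  set c := T₀ * M + k * (T₀ * (f u₀ + ε / 2)) with hc
  set s := f u₀ + σ + ε with hs
  have hb : Real.log κ + T * σ + c ≤ T * s := by
    have : 0 ≤ T₀ * (ε / 2) := by positivity
    rw [hT, hc, hs]
    nlinarith
  obtain ⟨Z, hZcard, hZball, hZcov⟩ := hcover T hTpos.le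
  obtain ⟨Ω, hΩcard, hΩ⟩ := exists_steeringFamily_of_cover (A := A) (B := B) (U := U) (f := f)
    (T := T) (c := c)
    (fun z hz => ((hball z (hZball z hz)).2.costSteers hUc hf hMu).iterate hUc hf
      (⟨hT₀.le, ω₀, hω₀, hω₀p, hcost⟩ : CostSteers A B U f T₀ _ p p) k) hZcov
  -- A finite initial phase brings K into the ball around p; it affects only the constant in the
  -- bound.
  obtain ⟨F, hF, hKF⟩ := exists_finset_steers_of_isCompact (A := A) (B := B) (U := U) hK
    (Metric.closedBall_mem_nhds p hδ) fun x hx => by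
      obtain ⟨T₂, hT₂⟩ := (hKD hx).1
      exact ⟨_, hT₂.trans hU h0p⟩
  obtain ⟨Tm, hTm⟩ := (F.image Prod.fst).exists_le
  have hTm' : ∀ q ∈ F, q.1 ≤ Tm := fun q hq => hTm _ (Finset.mem_image_of_mem _ hq)
  refine ⟨Real.log (F.card + 1) + (Tm * M + (Tm + T) * M) + T * |s|, fun τ hτ => ?_⟩
  -- Rounding up makes the words at least as long as τ, with an overshoot at most T plus the initial
  -- phase.
  set n := ⌈τ / T⌉₊ with hn
  have hn1 : τ ≤ n * T := (div_le_iff₀ hTpos).1 (Nat.le_ceil _)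
  have hn2 : n * T ≤ τ + T := by
    have := (Nat.ceil_lt_add_one (div_nonneg hτ hTpos.le)).le
    calc (n : ℝ) * T ≤ (τ / T + 1) * T := by gcongr
      _ = τ + T := by field_simp
  have hnT : 0 ≤ n * T := by positivity
  obtain ⟨Ω', hΩ'card, hΩ'⟩ := hΩ.exists_iterate hUc hf hTpos.le n
  set S := (F ×ˢ Ω').image fun q => concat q.1.1 q.1.2 q.2 with hS
  have hSmem : ∀ ω ∈ S, ∃ q ∈ F, ∃ ω' ∈ Ω', ω = concat q.1 q.2 ω' := by
    intro ω hω
    obtain ⟨⟨q, ω'⟩, hq, rfl⟩ := Finset.mem_image.1 hω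
    obtain ⟨h1, h2⟩ := Finset.mem_product.1 hq
    exact ⟨q, h1, ω', h2, rfl⟩
  have hScontrols : ∀ ω ∈ S, ω ∈ controls U := by
    intro ω hω
    obtain ⟨q, hq, ω', hω', rfl⟩ := hSmem ω hω
    exact concat_mem_controls (hF q hq).2 (hΩ'.mem_controls _ hω') _
  have hspan : ∀ x ∈ K, ∃ ω ∈ S, ∀ t ∈ Set.Icc (0 : ℝ) τ, sol A B x ω t ∈ coreSet A B U := by
    intro x hx
    obtain ⟨q, hq, hxq⟩ := hKF x hx
    obtain ⟨ω', hω', hxω'⟩ := hΩ'.steers _ hxq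
    have hmem : concat q.1 q.2 ω' ∈ S :=
      Finset.mem_image.2 ⟨(q, ω'), Finset.mem_product.2 ⟨hq, hω'⟩, rfl⟩
    have hq0 := (hF q hq).1
    refine ⟨_, hmem, fun t ht => ?_⟩
    -- Only the final point of the word has to be checked: the starting point lies in K, and the
    -- control set retains everything in between.
    refine (isControlSet_coreSet hAB hU hU0).sol_mem hU (hKD hx) (hScontrols _ hmem)
      (T := q.1 + n * T) ?_ ht.1 (by linarith [ht.2])
    rw [sol_concat_add A B x hU (hF q hq).2 (hΩ'.mem_controls _ hω') hq0 hnT]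
    exact (hball _ hxω').1
  have hScost : ∀ ω ∈ S, ∫ t in (0 : ℝ)..τ, f (ω t) ≤ n * c + (Tm * M + (Tm + T) * M) := by
    intro ω hω
    have hωU := hScontrols ω hω
    obtain ⟨q, hq, ω', hω', rfl⟩ := hSmem ω hω
    have hq0 := (hF q hq).1
    have hqm := hTm' q hq
    -- The cost up to τ is the cost of the whole word minus that of the overshoot; the latter has
    -- length at most Tm + T, and f is at least -M there.
    have hi := intervalIntegrable_comp_control hUc hf hωU
    have h1 := intervalIntegral.integral_add_adjacent_intervals (hi 0 τ) (hi τ (q.1 + n * T))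
    rw [integral_comp_concat hUc hf (hF q hq).2 (hΩ'.mem_controls _ hω') hq0 hnT] at h1
    have h2 := le_integral_comp_control hUc hf hωU hMl (a := τ) (b := q.1 + n * T) (by linarith)
    have h3 := integral_comp_control_le hUc hf (hF q hq).2 hMu hq0
    have h4 := hΩ'.cost_le _ hω'
    have h5 : (q.1 + n * T - τ) * M ≤ (Tm + T) * M := by
      gcongr
      linarith
    have h6 : q.1 * M ≤ Tm * M := by gcongr
    linarith
  have hScard : (S.card : ℝ) ≤ (F.card + 1) * Real.exp (n * (Real.log κ + T * σ)) := by
    have h1 : (S.card : ℝ) ≤ F.card * Ω'.card := by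
      exact_mod_cast Finset.card_image_le.trans (Finset.card_product F Ω').le
    have h2 : (Ω'.card : ℝ) ≤ Real.exp (n * (Real.log κ + T * σ)) := by
      calc (Ω'.card : ℝ) ≤ (Ω.card : ℝ) ^ n := by exact_mod_cast hΩ'card
        _ ≤ (κ * Real.exp (T * σ)) ^ n := by
            gcongr
            exact (Nat.cast_le.2 hΩcard).trans hZcard
        _ = Real.exp (n * (Real.log κ + T * σ)) := by
            rw [Real.exp_nat_mul, Real.exp_add, Real.exp_log hκ]
    refine h1.trans ?_
    gcongr
    linarith
  refine (spanningInf_le_of_finset hU hScontrols hspan hScard hScost).trans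
    (ENNReal.ofReal_le_ofReal ?_)
  have hlog : (F.card : ℝ) + 1 = Real.exp (Real.log (F.card + 1)) :=
    (Real.exp_log (by positivity)).symm
  rw [hlog, ← Real.exp_add, ← Real.exp_add, Real.log_exp]
  refine Real.exp_le_exp.2 ?_
  have h1 : n * (Real.log κ + T * σ + c) ≤ n * (T * s) := by gcongr
  have h2 : (n * T - τ) * s ≤ T * |s| := by
    calc (n * T - τ) * s ≤ (n * T - τ) * |s| := by
          gcongr
          exact le_abs_self s
      _ ≤ T * |s| := by
          gcongr
          linarith
  nlinarith

/-- The multiplicative constants become additive under the logarithm and vanish after division by τ.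
The constant c may depend on ε, since ε is fixed while τ tends to infinity. -/
theorem invariancePressure_eq_of_bounds {K Q : Set (Fin d → ℝ)} {s : ℝ}
    (hlow : ∃ k : ℝ, 0 < k ∧ ∀ τ : ℝ, 0 ≤ τ →
      ENNReal.ofReal (k * Real.exp (τ * s)) ≤ spanningInf A B U f K Q τ)
    (hup : ∀ ε : ℝ, 0 < ε → ∃ c : ℝ, ∀ τ : ℝ, 0 ≤ τ →
      spanningInf A B U f K Q τ ≤ ENNReal.ofReal (Real.exp (c + τ * (s + ε)))) :
    invariancePressure A B U f K Q = (s : EReal) := by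
  have hlogexp : ∀ x : ℝ, ENNReal.log (ENNReal.ofReal (Real.exp x)) = (x : EReal) := by
    intro x
    rw [ENNReal.log_ofReal_of_pos (Real.exp_pos x), Real.log_exp]
  have hlim : ∀ c r : ℝ, Tendsto (fun τ : ℝ => (((1 / τ) * (c + τ * r) : ℝ) : EReal)) atTop
      (𝓝 (r : EReal)) := by
    intro c r
    refine (continuous_coe_real_ereal.tendsto r).comp ?_
    have h1 : Tendsto (fun τ : ℝ => c * τ⁻¹ + r) atTop (𝓝 r) := by
      simpa using (tendsto_inv_atTop_zero.const_mul c).add_const r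
    refine h1.congr' ?_
    filter_upwards [eventually_gt_atTop 0] with τ hτ
    field_simp
  have hmono : ∀ τ : ℝ, 0 < τ → Monotone fun y : EReal => ((1 / τ : ℝ) : EReal) * y := by
    intro τ hτ y z hyz
    exact mul_le_mul_of_nonneg_left hyz (EReal.coe_nonneg.2 (by positivity))
  apply le_antisymm
  · refine EReal.le_of_forall_lt_iff_le.1 fun r hr => ?_
    have hr' : s < r := EReal.coe_lt_coe_iff.1 hr
    obtain ⟨c, hc⟩ := hup (r - s) (sub_pos.2 hr')
    rw [← (hlim c r).limsup_eq]
    refine limsup_le_limsup ?_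
    filter_upwards [eventually_gt_atTop 0] with τ hτ
    have h1 := hmono τ hτ (ENNReal.log_monotone (hc τ hτ.le))
    simp only [hlogexp, add_sub_cancel] at h1
    rwa [EReal.coe_mul]
  · obtain ⟨k, hk, hk'⟩ := hlow
    rw [← (hlim (Real.log k) s).limsup_eq]
    refine limsup_le_limsup ?_
    filter_upwards [eventually_gt_atTop 0] with τ hτ
    have h1 := hk' τ hτ.le
    rw [show k * Real.exp (τ * s) = Real.exp (Real.log k + τ * s) by
      rw [Real.exp_add, Real.exp_log hk]] at h1
    have h2 := hmono τ hτ (ENNReal.log_monotone h1)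
    simp only [hlogexp] at h2
    rwa [EReal.coe_mul]

end

end

end LinearControl

theorem mainTheorem3 {d m : ℕ} (A : Matrix (Fin d) (Fin d) ℝ) (B : Matrix (Fin d) (Fin m) ℝ)
    (U : Set (Fin m → ℝ))
    (hAB : LinearControl.IsControllable A B) (hA : LinearControl.IsHyperbolic A)
    (hUc : IsCompact U) (hU0 : U ∈ 𝓝 (0 : Fin m → ℝ)) :
    (∃! D : Set (Fin d → ℝ), LinearControl.IsControlSet A B U D ∧ (interior D).Nonempty) ∧
    ∀ D : Set (Fin d → ℝ), LinearControl.IsControlSet A B U D → (interior D).Nonempty →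
      ∀ K : Set (Fin d → ℝ), IsCompact K → K ⊆ D → (interior K).Nonempty →
        ∀ f : (Fin m → ℝ) → ℝ, ContinuousOn f U →
          ∃ u₀ ∈ U, IsMinOn f U u₀ ∧
            LinearControl.invariancePressure A B U f K D =
              ((f u₀ + ((LinearControl.eigenvalues A).map
                (fun μ : ℂ => max 0 μ.re)).sum : ℝ) : EReal) := by
  obtain ⟨P, C, α, hP⟩ := LinearControl.exists_isDichotomy A hA
  have hU := hUc.isBounded
  refine ⟨LinearControl.existsUnique_isControlSet hAB hU hU0 hP, ?_⟩
  intro D hD hDi K hK hKD hKi f hf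
  obtain rfl := hD.eq_coreSet hAB hU hU0 hP hDi
  obtain ⟨u₀, hu₀, hmin⟩ := hUc.exists_isMinOn ⟨0, mem_of_mem_nhds hU0⟩ hf
  refine ⟨u₀, hu₀, hmin, LinearControl.invariancePressure_eq_of_bounds ?_ ?_⟩
  · obtain ⟨R, hR⟩ := hU.exists_norm_le
    have hR0 : 0 ≤ R := (norm_nonneg _).trans (hR u₀ hu₀)
    refine hP.exists_le_spanningInf hUc hK hKi (R := C * ‖B‖ * R / α) ?_ hf fun u hu => hmin hu
    rintro x ⟨⟨T, hT⟩, -⟩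
    exact hP.norm_unstable_le hR hR0 hT
  · intro ε hε
    exact hP.exists_spanningInf_le hAB hUc hU0 hf hu₀ hmin hK hKD hε
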